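/- Let $m\ge 0$, $K\ge 0$ and $s\ge 1$ be integers and let $f:\mathbb R^m\times\mathbb R^m\to\mathbb R^m$ be of class $C^{2s}$. Let $y:[0,K]\to\mathbb R^m$ be a solution of the differential equation with piecewise continuous argument $$\dot y(t)=f\bigl(y(t),y(\lfloor t\rfloor)\bigr),\qquad y(0)=y_0,$$ that is, $y$ is continuous on $[0,K]$ and satisfies the equation on each interval $[\kappa,\kappa+1)$, $\kappa=0,\dots,K-1$ (with the right derivative at $t=\kappa$). Let $P_j$ ($j\ge 0$) be the Legendre polynomials orthonormal on $[0,1]$, with $\deg P_j=j$ and $\int_0^1P_iP_j\,dx=\delta_{ij}$. Let $(c_i,b_i)_{i=1}^k$, $c_i\in[0,1]$, be a quadrature formula of order $q\ge 2s$ on $[0,1]$, i.e. $\sum_{i=1}^k b_ip(c_i)=\int_0^1p(x)\,dx$ for all real polynomials $p$ of degree at most $q-1$. For an integer $\nu\ge 1$ put $h=1/\nu$, $N=K\nu$ and $t_n=nh$. A fully discrete HBVM approximation with stepsize $h$ is a function $u:[0,K]\to\mathbb R^m$ with $u(0)=y_0$ such that, for $n=1,\dots,N$ and $c\in[0,1]$,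 $$\dot u(t_{n-1}+ch)=\sum_{j=0}^{s-1}P_j(c)\,\bar\gamma_j^{\,n},\qquad \bar\gamma_j^{\,n}=\sum_{i=1}^k b_iP_j(c_i)\,f\bigl(u(t_{n-1}+c_ih),u(\lfloor t_{n-1}\rfloor)\bigr),$$ where $\dot u$ is the derivative within $[t_{n-1},t_n]$ (so $u$ is continuous, and a polynomial of degree at most $s$ on each $[t_{n-1},t_n]$). Let $R$ be such that $|y(t)|<R$ for all $t\in[0,K]$, where $|\cdot|$ is the Euclidean norm. Then: (a) for all sufficiently large $\nu$ there is exactly one HBVM approximation $u$ with stepsize $h=1/\nu$ such that $|u(t)|\le R$ for all $t\in[0,K]$; (b) there is a constant $C$, independent of $\nu$, $u$, $n$ and $c$, such that for every $\nu\ge1$ and every HBVM approximation $u$ with stepsize $h=1/\nu$ and $|u(t)|\le R$ on $[0,K]$, one has $$\bigl|\bigl(y(t_n)-u(t_n)\bigr)-\bigl(y(t_{n-1})-u(t_{n-1})\bigr)\bigr|\le C\,h^{2s+1},\qquad n=1,\dots,N,$$ $$\bigl|y(t_{n-1}+ch)-u(t_{n-1}+ch)\bigr|\le C\,h^{s+1},\qquad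 n=1,\dots,N,\quad c\in(0,1),$$ $$\bigl|y(t_n)-u(t_n)\bigr|\le C\,h^{2s},\qquad n=0,\dots,N.$$ -/

import Mathlib

namespace HBVM

section Legendre

open Polynomial intervalIntegral

/-- The Legendre polynomials shifted to `[0,1]` and normalised in `L²(0,1)`, with positive leading
coefficient (see `natDegree_legendre` and `legendre_orthonormal`). -/
noncomputable def legendre (j : ℕ) : ℝ[X] :=
  C (√(2 * j + 1) * (-1) ^ j) * (shiftedLegendre j).map (Int.castRingHom ℝ)

theorem pint_parts (p w : ℝ[X]) (h0 : w.eval 0 = 0) (h1 : w.eval 1 = 0) :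
    ∫ x in (0:ℝ)..1, p.eval x * (derivative w).eval x
      = -∫ x in (0:ℝ)..1, (derivative p).eval x * w.eval x := by
  rw [integral_mul_deriv_eq_deriv_mul (u := fun x => p.eval x) (v := fun x => w.eval x)
    (fun x _ => p.hasDerivAt x) (fun x _ => w.hasDerivAt x)
    ((derivative p).continuous.intervalIntegrable _ _)
    ((derivative w).continuous.intervalIntegrable _ _)]
  simp [h0, h1]

theorem pint_parts_iter (n : ℕ) (w : ℝ[X])
    (h0 : ∀ i < n, (derivative^[i] w).eval 0 = 0) (h1 : ∀ i < n, (derivative^[i] w).eval 1 = 0)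
    (p : ℝ[X]) :
    ∫ x in (0:ℝ)..1, p.eval x * (derivative^[n] w).eval x
      = (-1) ^ n * ∫ x in (0:ℝ)..1, (derivative^[n] p).eval x * w.eval x := by
  induction n generalizing p with
  | zero => simp
  | succ n ih =>
    rw [Function.iterate_succ_apply', pint_parts _ _ (h0 n (by omega)) (h1 n (by omega)),
      ih (fun i hi => h0 i (by omega)) (fun i hi => h1 i (by omega)), ← Function.iterate_succ_apply]
    ring

theorem int_beta (b a : ℕ) : ∫ x in (0:ℝ)..1, x ^ a * (1 - x) ^ b
    = (a.factorial * b.factorial : ℝ) / (a + b + 1).factorial := by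
  induction b generalizing a with
  | zero =>
    simp [Nat.factorial_succ]
    field_simp
  | succ b ih =>
    have h : ∀ x ∈ Set.uIcc (0:ℝ) 1, HasDerivAt (fun x : ℝ => (1 - x) ^ (b + 1))
        (-((b + 1 : ℝ) * (1 - x) ^ b)) x := by
      intro x _
      have := ((hasDerivAt_id x).const_sub 1).fun_pow (b + 1)
      simpa using this
    have h' : ∀ x ∈ Set.uIcc (0:ℝ) 1, HasDerivAt (fun x : ℝ => x ^ (a + 1) / (a + 1))
        (x ^ a) x := by
      intro x _
      have := ((hasDerivAt_pow (a + 1) x).div_const ((a : ℝ) + 1))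
      have e : ((a : ℝ) + 1) ≠ 0 := by positivity
      simpa [mul_div_cancel_left₀ _ e] using this
    have key := integral_mul_deriv_eq_deriv_mul h h'
      (Continuous.intervalIntegrable (by fun_prop) _ _)
      (Continuous.intervalIntegrable (by fun_prop) _ _)
    have e1 : ∫ x in (0:ℝ)..1, x ^ a * (1 - x) ^ (b + 1)
        = ∫ x in (0:ℝ)..1, (1 - x) ^ (b + 1) * x ^ a := by
      simp_rw [mul_comm]
    have e2 : ∫ x in (0:ℝ)..1, -((b + 1 : ℝ) * (1 - x) ^ b) * (x ^ (a + 1) / (a + 1))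
        = -((b + 1 : ℝ) / (a + 1)) * ∫ x in (0:ℝ)..1, x ^ (a + 1) * (1 - x) ^ b := by
      rw [← integral_const_mul]
      congr 1; ext x; field_simp
    rw [e1, key, e2, ih (a + 1)]
    rw [show a + 1 + b + 1 = a + (b + 1) + 1 by ring, Nat.factorial_succ a, Nat.factorial_succ b]
    push_cast
    field_simp
    simp

theorem rodrigues (n : ℕ) : C (n.factorial : ℝ) * (shiftedLegendre n).map (Int.castRingHom ℝ)
    = derivative^[n] (X ^ n * (1 - X) ^ n : ℝ[X]) := by
  have := congrArg (Polynomial.map (Int.castRingHom ℝ)) (factorial_mul_shiftedLegendre_eq n)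
  rw [← Polynomial.iterate_derivative_map] at this
  simpa using this

theorem dvd_iter (r : ℝ) (n i : ℕ) (hi : i < n) (w : ℝ[X]) (hw : (X - C r) ^ n ∣ w) :
    (derivative^[i] w).eval r = 0 := by
  have h := pow_sub_dvd_iterate_derivative_of_pow_dvd i hw
  have h2 : (X - C r) ∣ derivative^[i] w := (dvd_pow_self _ (by omega)).trans h
  exact dvd_iff_isRoot.1 h2

theorem int_legendre (n : ℕ) (p : ℝ[X]) :
    (n.factorial : ℝ) * ∫ x in (0:ℝ)..1, p.eval x * ((shiftedLegendre n).map (Int.castRingHom ℝ)).eval x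
      = (-1) ^ n * ∫ x in (0:ℝ)..1, (derivative^[n] p).eval x * (x ^ n * (1 - x) ^ n) := by
  have := pint_parts_iter n (X ^ n * (1 - X) ^ n)
    (fun i hi => dvd_iter 0 n i hi _ (by simp))
    (fun i hi => dvd_iter 1 n i hi _ (by
      refine Dvd.dvd.mul_left (pow_dvd_pow_of_dvd ?_ n) _
      rw [show (1 - X : ℝ[X]) = -(X - C 1) by simp]
      exact (dvd_neg).2 dvd_rfl)) p
  rw [← rodrigues] at this
  simp only [eval_mul, eval_C, eval_pow, eval_X, eval_sub, eval_one] at this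
  rw [← this, ← integral_const_mul]
  congr 1; ext x; ring

/-- `legendre j` has degree exactly `j`. -/
theorem natDegree_legendre (j : ℕ) : (legendre j).natDegree = j := by
  have h : √(2 * (j : ℝ) + 1) * (-1) ^ j ≠ 0 := by positivity
  rw [legendre, natDegree_C_mul h, natDegree_map_eq_of_injective (Int.cast_injective (α := ℝ)),
    natDegree_shiftedLegendre]

theorem int_legendre_lt (n : ℕ) (p : ℝ[X]) (hp : p.natDegree < n) :
    ∫ x in (0:ℝ)..1, p.eval x * (legendre n).eval x = 0 := by
  have := int_legendre n p
  rw [iterate_derivative_eq_zero hp] at this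
  simp only [eval_zero, zero_mul, integral_zero, mul_zero] at this
  have h := (mul_eq_zero.1 this).resolve_left (by positivity)
  have e : ∀ x : ℝ, p.eval x * (legendre n).eval x = (√(2 * n + 1) * (-1) ^ n) *
      (p.eval x * ((shiftedLegendre n).map (Int.castRingHom ℝ)).eval x) := by
    intro x
    rw [legendre, eval_mul, eval_C]
    ring
  rw [funext e, integral_const_mul, h, mul_zero]

theorem int_legendre_self (n : ℕ) :
    ∫ x in (0:ℝ)..1, (legendre n).eval x * (legendre n).eval x = 1 := by
  set S : ℝ[X] := (shiftedLegendre n).map (Int.castRingHom ℝ) with hS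
  have hd : S.natDegree = n := by
    rw [hS, natDegree_map_eq_of_injective (Int.cast_injective (α := ℝ)), natDegree_shiftedLegendre]
  have hD : derivative^[n] S = C ((n.factorial : ℝ) * ((-1) ^ n * (n + n).choose n)) := by
    have h0 : (derivative^[n] S).natDegree = 0 := by
      have := natDegree_iterate_derivative S n
      omega
    rw [eq_C_of_natDegree_eq_zero h0, coeff_iterate_derivative, hS, coeff_map,
      coeff_shiftedLegendre, Nat.zero_add, Nat.descFactorial_self]
    simp
  have h := int_legendre n S
  simp only [hD, eval_C, integral_const_mul, int_beta] at h
  have e : ∀ x : ℝ, (legendre n).eval x * (legendre n).eval x =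
      (2 * n + 1) * (S.eval x * S.eval x) := by
    intro x
    have h1 : √(2 * (n : ℝ) + 1) * √(2 * (n : ℝ) + 1) = 2 * n + 1 :=
      Real.mul_self_sqrt (by positivity)
    have h2 : ((-1 : ℝ) ^ n) * (-1) ^ n = 1 := by rw [← mul_pow]; simp
    rw [legendre, eval_mul, eval_C]
    calc _ = (√(2 * (n : ℝ) + 1) * √(2 * (n : ℝ) + 1)) * (((-1 : ℝ) ^ n) * (-1) ^ n) *
          (S.eval x * S.eval x) := by ring
      _ = _ := by rw [h1, h2, mul_one]
  rw [funext e, integral_const_mul]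
  have h2 : ((-1 : ℝ) ^ n) * (-1) ^ n = 1 := by rw [← mul_pow]; simp
  have hc : ((n + n).choose n : ℝ) * n.factorial * n.factorial = (n + n).factorial := by
    exact_mod_cast Nat.add_choose_mul_factorial_mul_factorial n n
  have hf : (n.factorial : ℝ) ≠ 0 := by positivity
  have hf2 : ((n + n).factorial : ℝ) ≠ 0 := by positivity
  have hq : ((n + n + 1).factorial : ℝ) = (2 * n + 1) * (n + n).factorial := by
    rw [Nat.factorial_succ]; push_cast; ring
  apply mul_left_cancel₀ hf
  rw [mul_left_comm, h, hq]
  have h3 : (-1 : ℝ) ^ n * (n.factorial * ((-1) ^ n * (n + n).choose n) *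
      (n.factorial * n.factorial / ((2 * n + 1) * (n + n).factorial))) =
      ((-1 : ℝ) ^ n * (-1) ^ n) * n.factorial * (((n + n).choose n * n.factorial * n.factorial) /
        ((2 * n + 1) * (n + n).factorial)) := by ring
  rw [h3, h2, hc]
  have : (2 * (n : ℝ) + 1) ≠ 0 := by positivity
  field_simp

/-- The polynomials `legendre j` are orthonormal in `L²(0,1)`. -/
theorem legendre_orthonormal (i j : ℕ) :
    ∫ x in (0:ℝ)..1, (legendre i).eval x * (legendre j).eval x = if i = j then 1 else 0 := by
  rcases lt_trichotomy i j with h | h | h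
  · rw [int_legendre_lt _ _ (by rwa [natDegree_legendre]), if_neg h.ne]
  · subst h
    simp [int_legendre_self]
  · rw [funext fun x : ℝ => mul_comm ((legendre i).eval x) ((legendre j).eval x)]
    rw [int_legendre_lt _ _ (by rwa [natDegree_legendre]), if_neg h.ne']

end Legendre

/-- `y` solves `y'(t) = f (y t, y ⌊t⌋)` on `[0, K]` with `y 0 = y₀`: it is continuous on `[0, K]`,
and the equation holds on every interval `[κ, κ+1) ⊆ [0, K]` with integer endpoints (the derivative
within `[κ, κ+1)` is the two-sided one at interior points and the right one at `κ`). -/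
structure IsFDEPCASolution {m : ℕ}
    (f : EuclideanSpace ℝ (Fin m) × EuclideanSpace ℝ (Fin m) → EuclideanSpace ℝ (Fin m))
    (y₀ : EuclideanSpace ℝ (Fin m)) (K : ℕ) (y : ℝ → EuclideanSpace ℝ (Fin m)) : Prop where
  initial : y 0 = y₀
  continuousOn : ContinuousOn y (Set.Icc 0 (K : ℝ))
  hasDeriv : ∀ κ : ℕ, κ < K → ∀ t ∈ Set.Ico (κ : ℝ) (κ + 1),
    HasDerivWithinAt y (f (y t, y (⌊t⌋ : ℝ))) (Set.Ico (κ : ℝ) (κ + 1)) t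

/-- The quadrature formula `∑ i, b i * g (c i)` for `∫ x in 0..1, g x` has order (at least) `q`:
it is exact for polynomials of degree at most `q - 1`. -/
def HasQuadratureOrder {k : ℕ} (c b : Fin k → ℝ) (q : ℕ) : Prop :=
  ∀ p : Polynomial ℝ, p.natDegree < q → ∑ i, b i * p.eval (c i) = ∫ x in (0 : ℝ)..1, p.eval x

/-- The discrete Fourier coefficient
`∑ i, bᵢ P_j(cᵢ) f (u(t_n + cᵢ h), u(⌊t_n⌋))` of the step from `t_n = n h` to `t_{n+1}`,
with `h = 1 / ν`. As `t_n = n / ν`, its integer part `⌊t_n⌋` is the natural number quotient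
`n / ν`, and `u(⌊t_n⌋)` is the constant memory term of this step. -/
noncomputable def fourierCoeff {m k : ℕ}
    (f : EuclideanSpace ℝ (Fin m) × EuclideanSpace ℝ (Fin m) → EuclideanSpace ℝ (Fin m))
    (c b : Fin k → ℝ) (ν : ℕ) (u : ℝ → EuclideanSpace ℝ (Fin m)) (n j : ℕ) :
    EuclideanSpace ℝ (Fin m) :=
  ∑ i, (b i * (legendre j).eval (c i)) •
    f (u (((n : ℝ) + c i) / ν), u ((n / ν : ℕ) : ℝ))

/-- `u` is an approximation on `[0, K]` produced by the HBVM with `s` Fourier coefficients,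
quadrature `(c, b)` and stepsize `h = 1 / ν`: `u 0 = y₀`, and on each of the `N = K ν` closed
subintervals `[t_n, t_{n+1}]`, `t_n = n h`, one has
`u'(t_n + τ h) = ∑_{j < s} P_j(τ) γ̄_j` for `τ ∈ [0,1]`. Hence `u` is continuous on `[0, K]` and is
a polynomial of degree at most `s` on each subinterval. -/
structure IsHBVMApprox {m k : ℕ}
    (f : EuclideanSpace ℝ (Fin m) × EuclideanSpace ℝ (Fin m) → EuclideanSpace ℝ (Fin m))
    (y₀ : EuclideanSpace ℝ (Fin m)) (K ν s : ℕ) (c b : Fin k → ℝ)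
    (u : ℝ → EuclideanSpace ℝ (Fin m)) : Prop where
  initial : u 0 = y₀
  hasDeriv : ∀ n : ℕ, n < K * ν → ∀ τ ∈ Set.Icc (0 : ℝ) 1,
    HasDerivWithinAt u
      (∑ j ∈ Finset.range s, (legendre j).eval τ • fourierCoeff f c b ν u n j)
      (Set.Icc ((n : ℝ) / ν) (((n : ℝ) + 1) / ν)) (((n : ℝ) + τ) / ν)

end HBVM

/-!
The proof is elementary: it uses neither the flow of the differential equation nor bounds on the
derivatives of the approximation `u`.

Fix one step of size `h`, scale its time to `τ ∈ [0, 1]`, and let `e = y - u`. With `δ` a bound for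
the errors at the left endpoint and in the memory term, the step satisfies
`‖e 1 - e 0‖ ≤ D (h δ + h ^ (2 s + 1))` and `‖e τ‖ ≤ D (δ + h ^ (s + 1))`
(`StepError.exists_norm_increment_le`). The discrete Gronwall inequality then gives the global
estimates (`exists_error_bound`); stepsizes that are not small are covered by the boundedness of `y`
and `u`.

For the local estimate let `e' = h w`, let `M r = h ∫ τ ^ r w`, so that `M 0 = e 1 - e 0`, and let
`S φ = ∑ i, b i φ (c i)`.
* Exactness of the quadrature formula up to degree `2 s - 1` makes the discrete Legendre projection
  reproduce polynomials of degree less than `s`, whence `e = O(δ + h ^ (s + 1))` and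
  `w = O(δ + h ^ s)`.
* For `r < s`, testing the method against `τ ^ r` gives `M r = h S (τ ^ r F) + O(h ^ (2 s + 1 - r))`,
  where `F` is the difference of the right-hand sides along `y` and `u`: the contribution of `u` is
  exact, and that of `y` is controlled by Taylor expansion, since `y` is of class `C ^ (2 s + 1)` on
  the closed unit intervals (`IsFDEPCASolution.contDiffOn`).
* Up to quadratic terms and `O(δ)` one has `F = A e`, where `A` depends only on `y` and is smooth in
  `h τ`. Expanding `A` in powers of `h τ` and replacing `S (τ ^ p e)`, `p < s`, by
  `∫ τ ^ p e = (e 1 - M (p + 1)) / (p + 1)` (an admissible error, as `u` is a polynomial of degree at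
  most `s` on the step) expresses `M r` through `M 0` and moments of higher degree, each with an
  additional power of `h`. Downward induction on `r` yields
  `M r = O(h δ + h ‖M 0‖ + h ^ (2 s + 1 - r))` (`StepError.norm_moment_le`), and for `r = 0` and
  small `h` the term `h ‖M 0‖` is absorbed.

These properties are collected in `StepError` and established in `exists_stepError`.

Existence follows by induction on the number of steps. The error estimate, valid for approximations
known on the first steps only, keeps `u` at a fixed distance from the boundary of the ball of radius
`R`, so the stage equations of the next step are a contraction of that ball
(`exists_stage_fixedPoint`). The same contraction gives uniqueness (`exists_eqOn_of_bounded`).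
-/

namespace HBVM

/-! ### Legendre expansions and quadrature -/

open Polynomial in
/-- The polynomials `legendre j`, `j < s`, span the polynomials of degree less than `s`. -/
theorem exists_legendre_expansion (s : ℕ) (p : ℝ[X]) (hp : p.degree < s) :
    ∃ a : ℕ → ℝ, p = ∑ j ∈ Finset.range s, C (a j) * legendre j := by
  induction s generalizing p with
  | zero =>
    refine ⟨0, ?_⟩
    rw [Finset.range_zero, Finset.sum_empty, ← degree_eq_bot]
    exact Nat.WithBot.lt_zero_iff.1 (by simpa using hp)
  | succ s ih =>
    have hL : (legendre s).coeff s ≠ 0 := by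
      have h0 : legendre s ≠ 0 := by
        intro h
        have := int_legendre_self s
        simp [h] at this
      have := leadingCoeff_ne_zero.2 h0
      rwa [leadingCoeff, natDegree_legendre] at this
    set α : ℝ := p.coeff s / (legendre s).coeff s with hα
    have hd : (p - C α * legendre s).degree < s := by
      rw [degree_lt_iff_coeff_zero] at hp ⊢
      intro i hi
      rw [coeff_sub, coeff_C_mul]
      rcases eq_or_lt_of_le hi with rfl | hi
      · rw [hα, div_mul_cancel₀ _ hL, sub_self]
      · rw [hp i hi, coeff_eq_zero_of_natDegree_lt (p := legendre s) (by rwa [natDegree_legendre])]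
        simp
    obtain ⟨a, ha⟩ := ih _ hd
    refine ⟨Function.update a s α, ?_⟩
    rw [Finset.sum_range_succ, Function.update_self]
    rw [Finset.sum_congr rfl (g := fun j => C (a j) * legendre j), ← ha, sub_add_cancel]
    intro j hj
    rw [Function.update_of_ne (Finset.mem_range.1 hj).ne]

/-- A monomial of degree less than `s` equals its Legendre expansion of length `s`. -/
theorem sum_integral_pow_mul_legendre {s r : ℕ} (hr : r < s) (x : ℝ) :
    ∑ j ∈ Finset.range s, (∫ t in (0 : ℝ)..1, t ^ r * (legendre j).eval t) * (legendre j).eval x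
      = x ^ r := by
  obtain ⟨a, ha⟩ := exists_legendre_expansion s (Polynomial.X ^ r) (by
    rw [Polynomial.degree_X_pow]; exact_mod_cast hr)
  have hev : ∀ t : ℝ, t ^ r = ∑ j ∈ Finset.range s, a j * (legendre j).eval t := by
    intro t
    have := congrArg (Polynomial.eval t) ha
    simpa [Polynomial.eval_finsetSum] using this
  rw [hev x]
  refine Finset.sum_congr rfl fun j hj => ?_
  congr 1
  simp_rw [hev, Finset.sum_mul]
  rw [intervalIntegral.integral_finsetSum]
  · simp_rw [mul_assoc, intervalIntegral.integral_const_mul, legendre_orthonormal]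
    simp [Finset.mem_range.1 hj]
  · intro i _
    exact Continuous.intervalIntegrable (by fun_prop) _ _

variable {k : ℕ} {c b : Fin k → ℝ} {q : ℕ}

theorem HasQuadratureOrder.sum_pow (hq : HasQuadratureOrder c b q) {l : ℕ} (hl : l < q) :
    ∑ i, b i * c i ^ l = 1 / ((l : ℝ) + 1) := by
  have := hq (Polynomial.X ^ l) (by simpa using hl)
  simpa using this

/-- The discrete Legendre projection, in which the Fourier coefficients are computed by the
quadrature formula, reproduces the monomials of degree less than `s`. -/
theorem HasQuadratureOrder.sum_legendre_mul_pow (hq : HasQuadratureOrder c b q) {s l : ℕ}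
    (hs : 2 * s ≤ q) (hl : l < s) (x : ℝ) :
    ∑ j ∈ Finset.range s, (legendre j).eval x * ∑ i, b i * (legendre j).eval (c i) * c i ^ l
      = x ^ l := by
  rw [← sum_integral_pow_mul_legendre hl x]
  refine Finset.sum_congr rfl fun j hj => ?_
  have hj' := Finset.mem_range.1 hj
  have := hq (Polynomial.X ^ l * legendre j) (by
    refine lt_of_le_of_lt Polynomial.natDegree_mul_le ?_
    rw [natDegree_legendre, Polynomial.natDegree_X_pow]; omega)
  simp only [Polynomial.eval_mul, Polynomial.eval_pow, Polynomial.eval_X] at this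
  rw [← this, mul_comm]
  congr 1
  exact Finset.sum_congr rfl fun i _ => by ring

variable {V : Type*} [NormedAddCommGroup V] [NormedSpace ℝ V] [CompleteSpace V]

/-- Quadrature error for `τ ^ r • φ τ` when `φ` is within `ε` of a polynomial `∑ l < p, τ ^ l • a l`
and the formula is exact on the product `τ ^ r • ∑ l < p, τ ^ l • a l`. -/
theorem HasQuadratureOrder.norm_integral_sub_sum_le (hq : HasQuadratureOrder c b q)
    (hc : ∀ i, c i ∈ Set.Icc (0 : ℝ) 1) {r p : ℕ} (hrp : r + p ≤ q) {φ : ℝ → V}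
    (hφ : ContinuousOn φ (Set.Icc 0 1)) (a : ℕ → V) {ε : ℝ}
    (hε : ∀ τ ∈ Set.Icc (0 : ℝ) 1, ‖φ τ - ∑ l ∈ Finset.range p, τ ^ l • a l‖ ≤ ε) :
    ‖(∫ τ in (0 : ℝ)..1, τ ^ r • φ τ) - ∑ i, (b i * c i ^ r) • φ (c i)‖
      ≤ (1 + ∑ i, |b i|) * ε := by
  have hpol : (∫ τ in (0 : ℝ)..1, τ ^ r • ∑ l ∈ Finset.range p, τ ^ l • a l)
      = ∑ i, (b i * c i ^ r) • ∑ l ∈ Finset.range p, c i ^ l • a l := by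
    simp_rw [Finset.smul_sum, smul_smul]
    rw [intervalIntegral.integral_finsetSum, Finset.sum_comm]
    · refine Finset.sum_congr rfl fun l hl => ?_
      rw [intervalIntegral.integral_smul_const, ← Finset.sum_smul]
      congr 1
      simp_rw [mul_assoc, ← pow_add]
      rw [hq.sum_pow (by have := Finset.mem_range.1 hl; omega), integral_pow]
      simp
    · intro l _
      exact Continuous.intervalIntegrable (by fun_prop) _ _
  have hI : (∫ τ in (0 : ℝ)..1, τ ^ r • φ τ)
        - (∫ τ in (0 : ℝ)..1, τ ^ r • ∑ l ∈ Finset.range p, τ ^ l • a l)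
      = ∫ τ in (0 : ℝ)..1, τ ^ r • (φ τ - ∑ l ∈ Finset.range p, τ ^ l • a l) := by
    rw [← intervalIntegral.integral_sub]
    · simp_rw [smul_sub]
    · refine ContinuousOn.intervalIntegrable ?_
      rw [Set.uIcc_of_le zero_le_one]
      fun_prop
    · exact Continuous.intervalIntegrable (by fun_prop) _ _
  have h1 : ‖∫ τ in (0 : ℝ)..1, τ ^ r • (φ τ - ∑ l ∈ Finset.range p, τ ^ l • a l)‖ ≤ ε := by
    have := intervalIntegral.norm_integral_le_of_norm_le_const (a := (0 : ℝ)) (b := 1)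
      (f := fun τ : ℝ => τ ^ r • (φ τ - ∑ l ∈ Finset.range p, τ ^ l • a l)) (C := ε) (by
        intro τ hτ
        rw [Set.uIoc_of_le zero_le_one] at hτ
        rw [norm_smul, norm_pow, Real.norm_of_nonneg hτ.1.le]
        exact (mul_le_of_le_one_left (norm_nonneg _) (pow_le_one₀ hτ.1.le hτ.2)).trans
          (hε τ ⟨hτ.1.le, hτ.2⟩))
    simpa using this
  have h2 : ‖∑ i, (b i * c i ^ r) • (φ (c i) - ∑ l ∈ Finset.range p, c i ^ l • a l)‖
      ≤ (∑ i, |b i|) * ε := by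
    rw [Finset.sum_mul]
    refine norm_sum_le_of_le _ fun i _ => ?_
    rw [norm_smul, norm_mul, norm_pow, Real.norm_eq_abs, Real.norm_of_nonneg (hc i).1]
    have := pow_le_one₀ (hc i).1 (hc i).2 (n := r)
    have h3 := hε _ (hc i)
    have h4 : 0 ≤ c i ^ r := pow_nonneg (hc i).1 r
    calc |b i| * c i ^ r * _ ≤ |b i| * 1 * ε := by gcongr
      _ = _ := by ring
  have e : (∫ τ in (0 : ℝ)..1, τ ^ r • φ τ) - ∑ i, (b i * c i ^ r) • φ (c i)
      = (∫ τ in (0 : ℝ)..1, τ ^ r • (φ τ - ∑ l ∈ Finset.range p, τ ^ l • a l))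
        - ∑ i, (b i * c i ^ r) • (φ (c i) - ∑ l ∈ Finset.range p, c i ^ l • a l) := by
    rw [← hI, hpol]
    simp_rw [smul_sub, Finset.sum_sub_distrib]
    abel
  rw [e]
  calc _ ≤ _ := norm_sub_le _ _
    _ ≤ ε + (∑ i, |b i|) * ε := add_le_add h1 h2
    _ = _ := by ring

end HBVM

namespace HBVM

/-! ### The error of a single step -/

/-- The relations satisfied by the error `e` of one step of size `h`, in the scaled time
`τ ∈ [0, 1]`. Here `h • w` is the derivative of `e`, the function `F` is the difference of the two
right-hand sides, `δ` bounds the errors at the left endpoint and in the memory term, and `C` is a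
constant independent of `h`. -/
structure StepError {V : Type*} [NormedAddCommGroup V] [NormedSpace ℝ V] {k : ℕ} (s : ℕ)
    (c b : Fin k → ℝ) (C h δ : ℝ) (e w F : ℝ → V) : Prop where
  one_le : 1 ≤ C
  node_mem : ∀ i, c i ∈ Set.Icc (0 : ℝ) 1
  sum_abs_le : ∑ i, |b i| ≤ C
  h_pos : 0 < h
  h_le : h ≤ 1
  nonneg : 0 ≤ δ
  le_const : δ ≤ C
  hasDeriv : ∀ τ ∈ Set.Icc (0 : ℝ) 1, HasDerivWithinAt e (h • w τ) (Set.Icc 0 1) τ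
  continuousOn : ContinuousOn w (Set.Icc 0 1)
  initial : ‖e 0‖ ≤ δ
  /-- A bound for `w` through the errors `M` of the stages; the term `h ^ s` comes from the
  reproduction of polynomials of degree less than `s` by the discrete projection. -/
  norm_w_le : ∀ M, (∀ i, ‖e (c i)‖ ≤ M) → ∀ τ ∈ Set.Icc (0 : ℝ) 1, ‖w τ‖ ≤ C * (h ^ s + M + δ)
  /-- The method satisfies the first `s` moment conditions up to quadrature errors. -/
  moment : ∀ r d, r + d = s → 0 < d →
    ‖(∫ τ in (0 : ℝ)..1, τ ^ r • w τ) - ∑ i, (b i * c i ^ r) • F (c i)‖ ≤ C * h ^ (s + d)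
  /-- Quadrature errors for the error itself. -/
  quadrature : ∀ r d, r + d = s → 0 < d →
    ‖(∫ τ in (0 : ℝ)..1, τ ^ r • e τ) - ∑ i, (b i * c i ^ r) • e (c i)‖ ≤ C * h ^ (s + d)
  /-- Linearisation of `F` with a coefficient that is a smooth function of `h * τ`. -/
  linear : ∃ (A : ℝ → V →L[ℝ] V) (a : ℕ → V →L[ℝ] V),
    (∀ i, ‖F (c i) - A (c i) (e (c i))‖ ≤ C * (‖e (c i)‖ ^ 2 + δ)) ∧
    (∀ l < s, ‖a l‖ ≤ C) ∧
    ∀ p ≤ s, ∀ i, ‖A (c i) - ∑ l ∈ Finset.range p, (h * c i) ^ l • a l‖ ≤ C * h ^ p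

namespace StepError

variable {V : Type*} [NormedAddCommGroup V] [NormedSpace ℝ V] {k s : ℕ}
  {c b : Fin k → ℝ} {C h δ : ℝ} {e w F : ℝ → V}

/-- The maximum of `‖e‖` appears on the right-hand side of the estimate with a factor `C * h` and is
absorbed. -/
theorem norm_le (H : StepError s c b C h δ e w F) (hC : C * h ≤ 1 / 2) :
    ∀ τ ∈ Set.Icc (0 : ℝ) 1, ‖e τ‖ ≤ 3 * C * (δ + h ^ (s + 1)) := by
  have hcont : ContinuousOn e (Set.Icc 0 1) := fun τ hτ => (H.hasDeriv τ hτ).continuousWithinAt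
  obtain ⟨σ, hσ, hmax⟩ := isCompact_Icc.exists_isMaxOn (Set.nonempty_Icc.2 (zero_le_one' ℝ))
    hcont.norm
  have hw := H.norm_w_le ‖e σ‖ (fun i => hmax (H.node_mem i))
  have hC1 := H.one_le
  have hh := H.h_pos
  have hδ := H.nonneg
  have hseg := norm_image_sub_le_of_norm_deriv_le_segment' H.hasDeriv
    (C := h * (C * (h ^ s + ‖e σ‖ + δ))) (fun x hx => by
      rw [norm_smul, Real.norm_of_nonneg hh.le]
      exact mul_le_mul_of_nonneg_left (hw x (Set.Ico_subset_Icc_self hx)) hh.le) σ hσ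
  have hb : 0 ≤ h * (C * (h ^ s + ‖e σ‖ + δ)) := by positivity
  have h1 : ‖e σ‖ ≤ δ + h * (C * (h ^ s + ‖e σ‖ + δ)) := by
    have h2 : ‖e σ‖ ≤ ‖e 0‖ + ‖e σ - e 0‖ := by
      simpa using norm_add_le (e 0) (e σ - e 0)
    have h3 : h * (C * (h ^ s + ‖e σ‖ + δ)) * (σ - 0) ≤ h * (C * (h ^ s + ‖e σ‖ + δ)) :=
      mul_le_of_le_one_right hb (by linarith [hσ.2])
    linarith [H.initial]
  have h4 : C * h * (‖e σ‖ + δ) ≤ 1 / 2 * (‖e σ‖ + δ) := by gcongr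
  have h5 : ‖e σ‖ ≤ 3 * δ + 2 * (C * h ^ (s + 1)) := by
    have : h * (C * (h ^ s + ‖e σ‖ + δ)) = C * h ^ (s + 1) + C * h * (‖e σ‖ + δ) := by ring
    linarith
  intro τ hτ
  have h6 : 0 ≤ C * h ^ (s + 1) := by positivity
  have h7 : δ ≤ C * δ := le_mul_of_one_le_left hδ hC1
  have h8 : ‖e τ‖ ≤ ‖e σ‖ := hmax hτ
  linarith

theorem norm_deriv_le (H : StepError s c b C h δ e w F) (hC : C * h ≤ 1 / 2) :
    ∀ τ ∈ Set.Icc (0 : ℝ) 1, ‖w τ‖ ≤ 4 * C ^ 2 * (δ + h ^ s) := by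
  intro τ hτ
  have hC1 := H.one_le
  have hh := H.h_pos
  have hδ := H.nonneg
  refine (H.norm_w_le _ (fun i => H.norm_le hC _ (H.node_mem i)) τ hτ).trans ?_
  have h1 : h ^ (s + 1) ≤ h ^ s := pow_le_pow_of_le_one hh.le H.h_le (Nat.le_succ s)
  have h2 : 0 ≤ h ^ s := by positivity
  calc C * (h ^ s + 3 * C * (δ + h ^ (s + 1)) + δ)
      ≤ C * (C * h ^ s + 3 * C * (δ + h ^ s) + C * δ) := by
        gcongr
        · exact le_mul_of_one_le_left h2 hC1
        · exact le_mul_of_one_le_left hδ hC1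
    _ = 4 * C ^ 2 * (δ + h ^ s) := by ring

variable [CompleteSpace V]

theorem integral_w (H : StepError s c b C h δ e w F) :
    h • ∫ τ in (0 : ℝ)..1, τ ^ 0 • w τ = e 1 - e 0 := by
  have hcont : ContinuousOn e (Set.Icc 0 1) := fun τ hτ => (H.hasDeriv τ hτ).continuousWithinAt
  rw [← intervalIntegral.integral_smul]
  simp only [pow_zero, one_smul]
  refine intervalIntegral.integral_eq_sub_of_hasDerivAt_of_le zero_le_one hcont
    (fun x hx => (H.hasDeriv x (Set.Ioo_subset_Icc_self hx)).hasDerivAt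
      (Icc_mem_nhds hx.1 hx.2)) ?_
  refine ContinuousOn.intervalIntegrable ?_
  rw [Set.uIcc_of_le zero_le_one]
  exact H.continuousOn.const_smul h

/-- Integration by parts, relating the moments of the error to those of its derivative. -/
theorem integral_pow_smul (H : StepError s c b C h δ e w F) (p : ℕ) :
    ((p : ℝ) + 1) • ∫ τ in (0 : ℝ)..1, τ ^ p • e τ
      = e 1 - h • ∫ τ in (0 : ℝ)..1, τ ^ (p + 1) • w τ := by
  have hcont : ContinuousOn e (Set.Icc 0 1) := fun τ hτ => (H.hasDeriv τ hτ).continuousWithinAt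
  have hw := H.continuousOn
  have key := intervalIntegral.integral_eq_sub_of_hasDerivAt_of_le (a := (0 : ℝ)) (b := 1)
    (f := fun τ => τ ^ (p + 1) • e τ)
    (f' := fun τ => τ ^ (p + 1) • (h • w τ) + (((p + 1 : ℕ) : ℝ) * τ ^ p) • e τ) zero_le_one
    (by fun_prop)
    (fun x hx => by
      have h1 := (H.hasDeriv x (Set.Ioo_subset_Icc_self hx)).hasDerivAt (Icc_mem_nhds hx.1 hx.2)
      have h2 := hasDerivAt_pow (p + 1) x
      simpa using h2.fun_smul h1)
    (by
      refine ContinuousOn.intervalIntegrable ?_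
      rw [Set.uIcc_of_le zero_le_one]
      fun_prop)
  rw [intervalIntegral.integral_add] at key
  · rw [← intervalIntegral.integral_smul, ← intervalIntegral.integral_smul, eq_sub_iff_add_eq']
    simp only [one_pow, one_smul, ne_eq, Nat.add_eq_zero_iff, one_ne_zero, and_false,
      not_false_eq_true, zero_pow, zero_smul, sub_zero] at key
    rw [← key]
    congr 2
    · ext τ; rw [smul_comm]
    · ext τ; rw [smul_smul]; push_cast; rfl
  all_goals
    refine ContinuousOn.intervalIntegrable ?_
    rw [Set.uIcc_of_le zero_le_one]
    fun_prop

/-- Downward induction on the degree `r = s - d` of the moment: the moment of degree `r` is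
estimated through moments of higher degree, each of which comes with a higher power of `h`. -/
theorem norm_moment_le (s : ℕ) (C : ℝ) (d : ℕ) :
    ∃ D : ℝ, 0 ≤ D ∧ ∀ (c b : Fin k → ℝ) (h δ : ℝ) (e w F : ℝ → V),
      StepError s c b C h δ e w F → C * h ≤ 1 / 2 → ∀ d' ≤ d, ∀ r, r + d' = s →
      ‖h • ∫ τ in (0 : ℝ)..1, τ ^ r • w τ‖ ≤ D * (h * (δ + ‖e 1 - e 0‖ + h ^ (s + d'))) := by
  induction d with
  | zero =>
    refine ⟨4 * C ^ 2, by positivity, fun c b h δ e w F H hC d' hd' r hr => ?_⟩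
    obtain rfl : d' = 0 := by omega
    have hh := H.h_pos
    have hδ := H.nonneg
    rw [norm_smul, Real.norm_of_nonneg hh.le]
    have h1 := intervalIntegral.norm_integral_le_of_norm_le_const (a := (0 : ℝ)) (b := 1)
      (f := fun τ : ℝ => τ ^ r • w τ) (C := 4 * C ^ 2 * (δ + h ^ s)) (by
        intro τ hτ
        rw [Set.uIoc_of_le zero_le_one] at hτ
        rw [norm_smul, norm_pow, Real.norm_of_nonneg hτ.1.le]
        exact (mul_le_of_le_one_left (norm_nonneg _) (pow_le_one₀ hτ.1.le hτ.2)).trans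
          (H.norm_deriv_le hC τ ⟨hτ.1.le, hτ.2⟩))
    rw [sub_zero, abs_one, mul_one] at h1
    have h2 := norm_nonneg (e 1 - e 0)
    calc h * _ ≤ h * (4 * C ^ 2 * (δ + h ^ s)) := by gcongr
      _ = 4 * C ^ 2 * (h * (δ + 0 + h ^ s)) := by ring
      _ ≤ 4 * C ^ 2 * (h * (δ + ‖e 1 - e 0‖ + h ^ (s + 0))) := by rw [add_zero s]; gcongr
  | succ d ih =>
    obtain ⟨D, hD, ih⟩ := ih
    set D' : ℝ := C + C * (C * (18 * C ^ 3 + 1)) + C * (C * (3 * C))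
      + (d + 1 : ℕ) * (C * (C + (1 + D))) with hD'
    refine ⟨D + |D'|, by positivity, fun c b h δ e w F H hC d' hd' r hr => ?_⟩
    have hC1 := H.one_le
    have hC0 : 0 ≤ C := by linarith
    have hh := H.h_pos
    have hh1 := H.h_le
    have hδ := H.nonneg
    have hn := norm_nonneg (e 1 - e 0)
    rcases Nat.lt_or_ge d d' with hlt | hge
    swap
    · refine (ih c b h δ e w F H hC d' hge r hr).trans ?_
      gcongr
      linarith [abs_nonneg D']
    obtain rfl : d' = d + 1 := by omega
    clear hd'
    set Z : ℝ := δ + ‖e 1 - e 0‖ + h ^ (s + (d + 1)) with hZ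
    have hpw : 0 ≤ h ^ (s + (d + 1)) := by positivity
    have hZ0 : 0 ≤ Z := by positivity
    obtain ⟨A, a, hF, ha, hA⟩ := H.linear
    have hem : ∀ i, ‖e (c i)‖ ≤ 3 * C * (δ + h ^ (s + 1)) := fun i =>
      H.norm_le hC _ (H.node_mem i)
    have hcp : ∀ i, ‖b i * c i ^ r‖ ≤ |b i| := fun i => by
      rw [norm_mul, norm_pow, Real.norm_eq_abs, Real.norm_of_nonneg (H.node_mem i).1]
      exact mul_le_of_le_one_right (abs_nonneg _)
        (pow_le_one₀ (H.node_mem i).1 (H.node_mem i).2)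
    have hsum : ∀ (v : Fin k → V) (B : ℝ), 0 ≤ B → (∀ i, ‖v i‖ ≤ B) →
        ‖∑ i, (b i * c i ^ r) • v i‖ ≤ C * B := fun v B hB hv => by
      calc _ ≤ ∑ i, |b i| * B := norm_sum_le_of_le _ fun i _ => by
            rw [norm_smul]
            exact mul_le_mul (hcp i) (hv i) (norm_nonneg _) (abs_nonneg _)
        _ ≤ C * B := by rw [← Finset.sum_mul]; gcongr; exact H.sum_abs_le
    -- the quadratic remainder of the linearisation
    have h2 : ‖∑ i, (b i * c i ^ r) • (F (c i) - A (c i) (e (c i)))‖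
        ≤ C * (C * (18 * C ^ 3 + 1) * Z) := by
      refine hsum _ _ (by positivity) fun i => (hF i).trans ?_
      have hp : h ^ (s + 1) * h ^ (s + 1) ≤ h ^ (s + (d + 1)) := by
        rw [← pow_add]
        exact pow_le_pow_of_le_one hh.le hh1 (by omega)
      have hq : (δ + h ^ (s + 1)) ^ 2 ≤ 2 * (C * Z) := by
        have h3 : (δ + h ^ (s + 1)) ^ 2 ≤ 2 * (δ ^ 2 + h ^ (s + 1) * h ^ (s + 1)) := by
          linarith [sq_nonneg (δ - h ^ (s + 1))]
        have h4 : δ ^ 2 ≤ C * δ := by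
          rw [sq]; exact mul_le_mul_of_nonneg_right H.le_const hδ
        have h5 : h ^ (s + (d + 1)) ≤ C * h ^ (s + (d + 1)) := le_mul_of_one_le_left hpw hC1
        have h6 : 0 ≤ C * ‖e 1 - e 0‖ := by positivity
        have h7 : C * Z = C * δ + C * ‖e 1 - e 0‖ + C * h ^ (s + (d + 1)) := by rw [hZ]; ring
        linarith
      calc C * (‖e (c i)‖ ^ 2 + δ) ≤ C * ((3 * C * (δ + h ^ (s + 1))) ^ 2 + Z) := by
            gcongr
            · exact hem i
            · rw [hZ]; linarith
        _ = C * (9 * C ^ 2 * (δ + h ^ (s + 1)) ^ 2 + Z) := by ring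
        _ ≤ C * (9 * C ^ 2 * (2 * (C * Z)) + Z) := by gcongr
        _ = _ := by ring
    -- the remainder of the expansion of the linear coefficient
    have h3 : ‖∑ i, (b i * c i ^ r) •
        ((A (c i) - ∑ l ∈ Finset.range (d + 1), (h * c i) ^ l • a l) (e (c i)))‖
        ≤ C * (C * (3 * C) * Z) := by
      refine hsum _ _ (by positivity) fun i => ?_
      refine (ContinuousLinearMap.le_opNorm _ _).trans ?_
      have h4 : h ^ (d + 1) * (δ + h ^ (s + 1)) ≤ Z := by
        have h5 : h ^ (d + 1) * δ ≤ δ := mul_le_of_le_one_left hδ (pow_le_one₀ hh.le hh1)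
        have h6 : h ^ (d + 1) * h ^ (s + 1) ≤ h ^ (s + (d + 1)) := by
          rw [← pow_add]
          exact pow_le_pow_of_le_one hh.le hh1 (by omega)
        rw [mul_add, hZ]
        linarith
      calc _ ≤ C * h ^ (d + 1) * (3 * C * (δ + h ^ (s + 1))) := by
            gcongr
            · exact hA _ (by omega) i
            · exact hem i
        _ = C * (3 * C) * (h ^ (d + 1) * (δ + h ^ (s + 1))) := by ring
        _ ≤ _ := by gcongr
    -- the terms of the expansion
    have h4 : ∀ l ∈ Finset.range (d + 1),
        ‖h ^ l • a l (∑ i, (b i * c i ^ (r + l)) • e (c i))‖ ≤ C * (C + (1 + D)) * Z := by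
      intro l hl
      have hl' := Finset.mem_range.1 hl
      rw [norm_smul, norm_pow, Real.norm_of_nonneg hh.le]
      have hql := H.quadrature (r + l) (d + 1 - l) (by omega) (by omega)
      have hpl : h ^ l * h ^ (s + (d + 1 - l)) = h ^ (s + (d + 1)) := by
        rw [← pow_add]; congr 1; omega
      have hil := H.integral_pow_smul (r + l)
      have hml := ih c b h δ e w F H hC (d - l) (by omega) (r + l + 1) (by omega)
      have hint : ‖∫ τ in (0 : ℝ)..1, τ ^ (r + l) • e τ‖
          ≤ δ + ‖e 1 - e 0‖ + D * (h * (δ + ‖e 1 - e 0‖ + h ^ (s + (d - l)))) := by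
        have hpos : (1 : ℝ) ≤ ((r + l : ℕ) : ℝ) + 1 := by
          have : (0 : ℝ) ≤ ((r + l : ℕ) : ℝ) := by positivity
          linarith
        have h5 : ‖∫ τ in (0 : ℝ)..1, τ ^ (r + l) • e τ‖
            ≤ ‖(((r + l : ℕ) : ℝ) + 1) • ∫ τ in (0 : ℝ)..1, τ ^ (r + l) • e τ‖ := by
          rw [norm_smul, Real.norm_of_nonneg (by linarith)]
          exact le_mul_of_one_le_left (norm_nonneg _) hpos
        rw [hil] at h5
        have h6 : ‖e 1‖ ≤ ‖e 0‖ + ‖e 1 - e 0‖ := by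
          simpa using norm_add_le (e 0) (e 1 - e 0)
        have h7 := norm_sub_le (e 1) (h • ∫ τ in (0 : ℝ)..1, τ ^ (r + l + 1) • w τ)
        linarith [H.initial]
      have hS : ‖∑ i, (b i * c i ^ (r + l)) • e (c i)‖
          ≤ C * h ^ (s + (d + 1 - l))
            + (δ + ‖e 1 - e 0‖ + D * (h * (δ + ‖e 1 - e 0‖ + h ^ (s + (d - l))))) := by
        rw [norm_sub_rev] at hql
        have := norm_le_norm_add_norm_sub' (∑ i, (b i * c i ^ (r + l)) • e (c i))
          (∫ τ in (0 : ℝ)..1, τ ^ (r + l) • e τ)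
        linarith
      have hl1 : h ^ l ≤ 1 := pow_le_one₀ hh.le hh1
      have hl0 : 0 ≤ h ^ l := by positivity
      have hX : 0 ≤ δ + ‖e 1 - e 0‖ := by positivity
      have e1 : h * h ^ (s + (d - l)) = h ^ (s + (d + 1 - l)) := by
        rw [← pow_succ']; congr 1; omega
      have e2 : h ^ l * (C * h ^ (s + (d + 1 - l))
            + (δ + ‖e 1 - e 0‖ + D * (h * (δ + ‖e 1 - e 0‖ + h ^ (s + (d - l))))))
          = (C + D) * h ^ (s + (d + 1))
            + h ^ l * (δ + ‖e 1 - e 0‖) + D * (h * h ^ l * (δ + ‖e 1 - e 0‖)) := by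
        rw [mul_add h, e1, ← hpl]; ring
      have e3 : h ^ l * (δ + ‖e 1 - e 0‖) ≤ δ + ‖e 1 - e 0‖ := mul_le_of_le_one_left hX hl1
      have e4 : D * (h * h ^ l * (δ + ‖e 1 - e 0‖)) ≤ D * (δ + ‖e 1 - e 0‖) := by
        gcongr
        exact mul_le_of_le_one_left hX (mul_le_one₀ hh1 hl0 hl1)
      have e5 : h ^ l * (C * h ^ (s + (d + 1 - l))
            + (δ + ‖e 1 - e 0‖ + D * (h * (δ + ‖e 1 - e 0‖ + h ^ (s + (d - l))))))
          ≤ (C + (1 + D)) * Z := by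
        rw [e2, hZ]
        have : 0 ≤ C * (δ + ‖e 1 - e 0‖) := by positivity
        linarith
      calc _ ≤ h ^ l * (C * (C * h ^ (s + (d + 1 - l))
            + (δ + ‖e 1 - e 0‖ + D * (h * (δ + ‖e 1 - e 0‖ + h ^ (s + (d - l))))))) := by
            refine mul_le_mul_of_nonneg_left ?_ hl0
            refine (ContinuousLinearMap.le_opNorm _ _).trans ?_
            exact mul_le_mul (ha l (by omega)) hS (norm_nonneg _) hC0
        _ = C * (h ^ l * (C * h ^ (s + (d + 1 - l))
            + (δ + ‖e 1 - e 0‖ + D * (h * (δ + ‖e 1 - e 0‖ + h ^ (s + (d - l))))))) := by ring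
        _ ≤ C * ((C + (1 + D)) * Z) := by gcongr
        _ = _ := by ring
    have h5 : ‖∑ l ∈ Finset.range (d + 1), h ^ l • a l (∑ i, (b i * c i ^ (r + l)) • e (c i))‖
        ≤ (d + 1 : ℕ) * (C * (C + (1 + D)) * Z) := by
      refine (norm_sum_le_of_le _ h4).trans ?_
      rw [Finset.sum_const, Finset.card_range, nsmul_eq_mul]
    have hsplit : ∑ i, (b i * c i ^ r) • F (c i)
        = ∑ i, (b i * c i ^ r) • (F (c i) - A (c i) (e (c i)))
          + ∑ i, (b i * c i ^ r) •
            ((A (c i) - ∑ l ∈ Finset.range (d + 1), (h * c i) ^ l • a l) (e (c i)))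
          + ∑ l ∈ Finset.range (d + 1), h ^ l • a l (∑ i, (b i * c i ^ (r + l)) • e (c i)) := by
      have : ∑ l ∈ Finset.range (d + 1), h ^ l • a l (∑ i, (b i * c i ^ (r + l)) • e (c i))
          = ∑ i, (b i * c i ^ r) •
            ((∑ l ∈ Finset.range (d + 1), (h * c i) ^ l • a l) (e (c i))) := by
        simp_rw [map_sum, Finset.smul_sum, sum_apply]
        rw [Finset.sum_comm]
        refine Finset.sum_congr rfl fun i _ => ?_
        rw [Finset.smul_sum]
        refine Finset.sum_congr rfl fun l _ => ?_
        rw [map_smul, smul_apply, smul_smul, smul_smul]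
        congr 1
        ring
      rw [this, ← Finset.sum_add_distrib, ← Finset.sum_add_distrib]
      refine Finset.sum_congr rfl fun i _ => ?_
      rw [← smul_add, ← smul_add, sub_apply]
      congr 1
      abel
    have h6 : ‖∑ i, (b i * c i ^ r) • F (c i)‖
        ≤ C * (C * (18 * C ^ 3 + 1) * Z) + C * (C * (3 * C) * Z)
          + (d + 1 : ℕ) * (C * (C + (1 + D)) * Z) := by
      rw [hsplit]
      exact norm_add₃_le.trans (by linarith)
    have h7 := H.moment r (d + 1) hr (by omega)
    have h8 : ‖∫ τ in (0 : ℝ)..1, τ ^ r • w τ‖ ≤ D' * Z := by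
      have h9 := norm_le_norm_add_norm_sub' (∫ τ in (0 : ℝ)..1, τ ^ r • w τ)
        (∑ i, (b i * c i ^ r) • F (c i))
      have h10 : C * h ^ (s + (d + 1)) ≤ C * Z := by
        gcongr
        rw [hZ]; linarith
      rw [hD']
      linarith
    rw [norm_smul, Real.norm_of_nonneg hh.le]
    calc h * _ ≤ h * (D' * Z) := by gcongr
      _ = D' * (h * Z) := by ring
      _ ≤ (D + |D'|) * (h * Z) := by
        gcongr
        linarith [le_abs_self D']

/-- Superconvergence of a single step: the increment `e 1 - e 0` is small of order `2 s + 1`, whereas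
`e` itself is only of order `s + 1` inside the step. -/
theorem exists_norm_increment_le (k s : ℕ) (C : ℝ) :
    ∃ D h₀ : ℝ, 0 ≤ D ∧ 0 < h₀ ∧ ∀ (c b : Fin k → ℝ) (h δ : ℝ) (e w F : ℝ → V),
      StepError s c b C h δ e w F → h ≤ h₀ →
      ‖e 1 - e 0‖ ≤ D * (h * δ + h ^ (2 * s + 1)) ∧
      ∀ τ ∈ Set.Icc (0 : ℝ) 1, ‖e τ‖ ≤ D * (δ + h ^ (s + 1)) := by
  obtain ⟨D, hD, hDle⟩ := norm_moment_le (V := V) (k := k) s C s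
  refine ⟨2 * D + 3 * |C|, min (1 / (2 * (|C| + 1))) (1 / (2 * (D + 1))), by positivity,
    by positivity, fun c b h δ e w F H hh₀ => ?_⟩
  have hC1 := H.one_le
  have hh := H.h_pos
  have hδ := H.nonneg
  have hCabs : |C| = C := abs_of_nonneg (by linarith)
  rw [hCabs] at hh₀ ⊢
  have a1 : C * h ≤ 1 / 2 := by
    have := hh₀.trans (min_le_left _ _)
    rw [le_div_iff₀ (by positivity)] at this
    linarith
  have a2 : D * h ≤ 1 / 2 := by
    have := hh₀.trans (min_le_right _ _)
    rw [le_div_iff₀ (by positivity)] at this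
    linarith
  have a3 := hDle c b h δ e w F H a1 s le_rfl 0 (by omega)
  rw [H.integral_w] at a3
  have a4 : D * h * ‖e 1 - e 0‖ ≤ 1 / 2 * ‖e 1 - e 0‖ := by gcongr
  have a5 : D * (h * (δ + ‖e 1 - e 0‖ + h ^ (s + s)))
      = D * (h * δ + h ^ (2 * s + 1)) + D * h * ‖e 1 - e 0‖ := by ring
  have a6 : 0 ≤ C * (h * δ + h ^ (2 * s + 1)) := by positivity
  refine ⟨by linarith, fun τ hτ => (H.norm_le a1 τ hτ).trans ?_⟩
  gcongr
  linarith

end StepError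

end HBVM

namespace HBVM

/-! ### Taylor expansions and smoothness of the solution -/

open Set Filter Topology

section Taylor

variable {V : Type*} [NormedAddCommGroup V] [NormedSpace ℝ V]

/-- `φ` has Taylor expansions of all orders `p ≤ n` to the right of every point of `[a, b)`, with
coefficients and remainders controlled by the single constant `C`. -/
def HasTaylorBound (φ : ℝ → V) (a b : ℝ) (n : ℕ) (C : ℝ) : Prop :=
  ∀ t₀ ∈ Ico a b, ∃ v : ℕ → V, (∀ l < n, ‖v l‖ ≤ C) ∧
    ∀ p ≤ n, ∀ t ∈ Icc t₀ b,
      ‖φ t - ∑ l ∈ Finset.range p, (t - t₀) ^ l • v l‖ ≤ C * (t - t₀) ^ p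

theorem HasTaylorBound.mono {φ : ℝ → V} {a b : ℝ} {n : ℕ} {C C' : ℝ}
    (h : HasTaylorBound φ a b n C) (hC : C ≤ C') : HasTaylorBound φ a b n C' := by
  intro t₀ ht₀
  obtain ⟨v, hv, hr⟩ := h t₀ ht₀
  refine ⟨v, fun l hl => (hv l hl).trans hC, fun p hp t ht => (hr p hp t ht).trans ?_⟩
  have := pow_nonneg (sub_nonneg.2 ht.1) p
  gcongr

theorem exists_hasTaylorBound {φ : ℝ → V} {a b : ℝ} {n : ℕ}
    (hφ : ContDiffOn ℝ n φ (Icc a b)) : ∃ C, HasTaylorBound φ a b n C := by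
  have hB : ∀ p, ∃ B : ℝ, p ≤ n → ∀ t ∈ Icc a b, ‖iteratedDerivWithin p φ (Icc a b) t‖ ≤ B := by
    intro p
    rcases Nat.lt_or_ge n p with hp | hp
    · exact ⟨0, fun h => absurd h (by omega)⟩
    rcases lt_or_ge a b with hab | hab
    · obtain ⟨B, hB⟩ := isCompact_Icc.exists_bound_of_continuousOn
        (hφ.continuousOn_iteratedDerivWithin (m := p) (by exact_mod_cast hp)
          (uniqueDiffOn_Icc hab))
      exact ⟨B, fun _ => hB⟩
    · refine ⟨‖iteratedDerivWithin p φ (Icc a b) a‖, fun _ t ht => ?_⟩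
      obtain rfl : t = a := le_antisymm (ht.2.trans hab) ht.1
      exact le_rfl
  choose B hB using hB
  refine ⟨∑ p ∈ Finset.range (n + 1), |B p|, fun t₀ ht₀ => ?_⟩
  have hC : ∀ p ≤ n, B p ≤ ∑ p ∈ Finset.range (n + 1), |B p| := fun p hp =>
    (le_abs_self _).trans (Finset.single_le_sum (f := fun p => |B p|)
      (fun i _ => abs_nonneg _) (Finset.mem_range.2 (by omega)))
  have hsub : Icc t₀ b ⊆ Icc a b := Icc_subset_Icc_left ht₀.1
  have hB' : ∀ p ≤ n, ∀ t ∈ Icc t₀ b, ‖iteratedDerivWithin p φ (Icc t₀ b) t‖ ≤ B p := by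
    intro p hp t ht
    have : iteratedDerivWithin p φ (Icc t₀ b) t = iteratedDerivWithin p φ (Icc a b) t := by
      rw [iteratedDerivWithin, iteratedDerivWithin,
        iteratedFDerivWithin_subset hsub (uniqueDiffOn_Icc ht₀.2)
          (uniqueDiffOn_Icc (ht₀.1.trans_lt ht₀.2)) (hφ.of_le (by exact_mod_cast hp)) ht]
    rw [this]
    exact hB p hp t (hsub ht)
  refine ⟨fun l => ((l.factorial : ℝ)⁻¹) • iteratedDerivWithin l φ (Icc t₀ b) t₀,
    fun l hl => ?_, fun p hp t ht => ?_⟩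
  · refine le_trans ?_ (hC l hl.le)
    rw [norm_smul, norm_inv, RCLike.norm_natCast]
    refine (mul_le_of_le_one_left (norm_nonneg _) ?_).trans
      (hB' l hl.le t₀ (left_mem_Icc.2 ht₀.2.le))
    exact inv_le_one_of_one_le₀ (by exact_mod_cast Nat.one_le_iff_ne_zero.2 l.factorial_ne_zero)
  · have ht0 : 0 ≤ t - t₀ := sub_nonneg.2 ht.1
    refine le_trans ?_ (mul_le_mul_of_nonneg_right (hC p hp) (pow_nonneg ht0 p))
    rcases p with _ | p
    · have := hB' 0 (Nat.zero_le _) t ht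
      simpa using this
    · have := taylor_mean_remainder_bound (n := p) ht₀.2.le
        ((hφ.mono hsub).of_le (by exact_mod_cast hp)) ht (hB' (p + 1) hp)
      rw [taylor_within_apply] at this
      simp_rw [smul_smul]
      simp_rw [mul_comm ((_ : ℝ)⁻¹) _] at this
      refine this.trans (div_le_self ?_ ?_)
      · exact mul_nonneg ((norm_nonneg _).trans (hB' (p + 1) hp t ht)) (pow_nonneg ht0 _)
      · exact_mod_cast Nat.one_le_iff_ne_zero.2 p.factorial_ne_zero

/-- A Taylor bound with one constant for finitely many unit intervals. -/
theorem exists_hasTaylorBound_forall_lt {φ : ℕ → ℝ → V} {n K : ℕ}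
    (hφ : ∀ κ < K, ContDiffOn ℝ n (φ κ) (Icc (κ : ℝ) (κ + 1))) :
    ∃ C, 0 ≤ C ∧ ∀ κ < K, HasTaylorBound (φ κ) κ (κ + 1) n C := by
  have h : ∀ κ, ∃ C, κ < K → HasTaylorBound (φ κ) κ (κ + 1) n C := fun κ => by
    by_cases hκ : κ < K
    · obtain ⟨C, hC⟩ := exists_hasTaylorBound (hφ κ hκ)
      exact ⟨C, fun _ => hC⟩
    · exact ⟨0, fun h => absurd h hκ⟩
  choose C hC using h
  refine ⟨∑ κ ∈ Finset.range K, |C κ|, Finset.sum_nonneg fun _ _ => abs_nonneg _,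
    fun κ hκ => (hC κ hκ).mono ?_⟩
  exact (le_abs_self _).trans (Finset.single_le_sum (f := fun p => |C p|)
      (fun i _ => abs_nonneg _) (Finset.mem_range.2 hκ))

end Taylor

section Smoothness

variable {V : Type*} [NormedAddCommGroup V] [NormedSpace ℝ V]

/-- A solution of an autonomous equation with `C^n` right-hand side is of class `C^(n+1)`. -/
theorem contDiffOn_of_hasDerivWithinAt {g : V → V} {y : ℝ → V} {a b : ℝ} (hab : a < b) {n : ℕ}
    (hg : ContDiff ℝ n g)
    (hy : ∀ t ∈ Icc a b, HasDerivWithinAt y (g (y t)) (Icc a b) t) :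
    ContDiffOn ℝ (n + 1 : ℕ) y (Icc a b) := by
  have hu := uniqueDiffOn_Icc hab
  have key : ∀ j ≤ n + 1, ContDiffOn ℝ (j : ℕ) y (Icc a b) := by
    intro j
    induction j with
    | zero =>
      intro _
      rw [Nat.cast_zero, contDiffOn_zero]
      exact fun t ht => (hy t ht).continuousWithinAt
    | succ j ih =>
      intro hj
      rw [Nat.cast_succ, contDiffOn_succ_iff_derivWithin hu]
      refine ⟨fun t ht => (hy t ht).differentiableWithinAt, by simp, ?_⟩
      refine ((hg.of_le (by exact_mod_cast (by omega : j ≤ n))).comp_contDiffOn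
        (ih (by omega))).congr fun t ht => ?_
      exact (hy t ht).derivWithin (hu t ht)
  exact key _ le_rfl

variable {m : ℕ}
  {f : EuclideanSpace ℝ (Fin m) × EuclideanSpace ℝ (Fin m) → EuclideanSpace ℝ (Fin m)}
  {y₀ : EuclideanSpace ℝ (Fin m)} {y : ℝ → EuclideanSpace ℝ (Fin m)} {K : ℕ}

/-- On a closed unit interval the equation holds up to the right endpoint, where it is satisfied by
the left derivative; the memory term is the value at the left endpoint. -/
theorem IsFDEPCASolution.hasDerivWithinAt_Icc (hf : Continuous f)
    (hy : IsFDEPCASolution f y₀ K y) {κ : ℕ} (hκ : κ < K) {t : ℝ}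
    (ht : t ∈ Icc (κ : ℝ) (κ + 1)) :
    HasDerivWithinAt y (f (y t, y κ)) (Icc (κ : ℝ) (κ + 1)) t := by
  have hfl : ∀ x ∈ Ico (κ : ℝ) (κ + 1), ((⌊x⌋ : ℤ) : ℝ) = κ := by
    intro x hx
    have : ⌊x⌋ = (κ : ℤ) := by
      rw [Int.floor_eq_iff]
      exact_mod_cast hx
    rw [this]; simp
  have hd : ∀ x ∈ Ico (κ : ℝ) (κ + 1),
      HasDerivWithinAt y (f (y x, y κ)) (Ico (κ : ℝ) (κ + 1)) x := by
    intro x hx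
    have := hy.hasDeriv κ hκ x hx
    rwa [hfl x hx] at this
  have hκK : (κ : ℝ) + 1 ≤ K := by exact_mod_cast hκ
  have hcont : ContinuousOn y (Icc (κ : ℝ) (κ + 1)) :=
    hy.continuousOn.mono (Icc_subset_Icc (Nat.cast_nonneg κ) hκK)
  rcases ht.2.lt_or_eq with hlt | rfl
  · refine (hd t ⟨ht.1, hlt⟩).mono_of_mem_nhdsWithin ?_
    have := inter_mem_nhdsWithin (Icc (κ : ℝ) (κ + 1)) (Iio_mem_nhds hlt)
    refine mem_of_superset this fun x hx => ⟨hx.1.1, hx.2⟩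
  · have hlt : (κ : ℝ) < κ + 1 := lt_add_one _
    have hd' : ∀ x ∈ Ioo (κ : ℝ) (κ + 1), HasDerivAt y (f (y x, y κ)) x := fun x hx =>
      (hd x (Ioo_subset_Ico_self hx)).hasDerivAt (Ico_mem_nhds hx.1 hx.2)
    have hcw : ContinuousWithinAt y (Ioo (κ : ℝ) (κ + 1)) (κ + 1) :=
      (hcont _ (right_mem_Icc.2 hlt.le)).mono Ioo_subset_Icc_self
    refine (hasDerivWithinAt_Iic_of_tendsto_deriv (s := Ioo (κ : ℝ) (κ + 1))
      (fun x hx => (hd' x hx).differentiableAt.differentiableWithinAt) hcw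
      (Ioo_mem_nhdsLT hlt) ?_).mono Icc_subset_Iic_self
    rw [← nhdsWithin_Ioo_eq_nhdsLT hlt]
    have h1 : Tendsto (fun x => f (y x, y κ)) (𝓝[Ioo (κ : ℝ) (κ + 1)] (κ + 1))
        (𝓝 (f (y (κ + 1), y κ))) :=
      (hf.tendsto _).comp (Tendsto.prodMk_nhds hcw tendsto_const_nhds)
    refine h1.congr' ?_
    filter_upwards [self_mem_nhdsWithin] with x hx
    exact ((hd' x hx).deriv).symm

theorem IsFDEPCASolution.contDiffOn {n : ℕ} (hf : ContDiff ℝ n f)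
    (hy : IsFDEPCASolution f y₀ K y) {κ : ℕ} (hκ : κ < K) :
    ContDiffOn ℝ (n + 1 : ℕ) y (Icc (κ : ℝ) (κ + 1)) :=
  contDiffOn_of_hasDerivWithinAt (g := fun v => f (v, y κ)) (lt_add_one _)
    (hf.comp (contDiff_id.prodMk contDiff_const))
    fun _ ht => hy.hasDerivWithinAt_Icc hf.continuous hκ ht

end Smoothness

/-- Bounds on a ball for a `C²` function and its linearisation. -/
theorem exists_bounds_on_closedBall {E V : Type*} [NormedAddCommGroup E] [NormedSpace ℝ E]
    [ProperSpace E] [NormedAddCommGroup V] [NormedSpace ℝ V] {f : E → V} (hf : ContDiff ℝ 2 f)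
    (R : ℝ) :
    ∃ B, 0 ≤ B ∧ (∀ w, ‖w‖ ≤ R → ‖f w‖ ≤ B ∧ ‖fderiv ℝ f w‖ ≤ B) ∧
      ∀ w z, ‖w‖ ≤ R → ‖z‖ ≤ R → ‖f w - f z‖ ≤ B * ‖w - z‖ ∧
        ‖f w - f z - fderiv ℝ f w (w - z)‖ ≤ B * ‖w - z‖ ^ 2 := by
  have hf1 : ContDiff ℝ 1 (fderiv ℝ f) := hf.fderiv_right (by norm_num)
  have hK : IsCompact (Metric.closedBall (0 : E) R) := isCompact_closedBall 0 R
  obtain ⟨B₀, hB₀⟩ := hK.exists_bound_of_continuousOn hf.continuous.continuousOn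
  obtain ⟨B₁, hB₁⟩ := hK.exists_bound_of_continuousOn hf1.continuous.continuousOn
  obtain ⟨B₂, hB₂⟩ := hK.exists_bound_of_continuousOn
    (hf1.continuous_fderiv (by norm_num)).continuousOn
  have hconv : Convex ℝ (Metric.closedBall (0 : E) R) := convex_closedBall 0 R
  have mem : ∀ w : E, ‖w‖ ≤ R → w ∈ Metric.closedBall (0 : E) R := fun w hw => by simpa using hw
  have h0 := abs_nonneg B₀
  have h1 := abs_nonneg B₁
  have h2 := abs_nonneg B₂
  refine ⟨|B₀| + |B₁| + |B₂|, by positivity, fun w hw => ⟨?_, ?_⟩, fun w z hw hz => ⟨?_, ?_⟩⟩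
  · linarith [hB₀ w (mem w hw), le_abs_self B₀]
  · linarith [hB₁ w (mem w hw), le_abs_self B₁]
  · refine (hconv.norm_image_sub_le_of_norm_fderiv_le
      (fun x _ => hf.differentiable (by norm_num) x) hB₁ (mem z hz) (mem w hw)).trans ?_
    gcongr
    linarith [le_abs_self B₁]
  · have hseg : segment ℝ z w ⊆ Metric.closedBall (0 : E) R :=
      hconv.segment_subset (mem z hz) (mem w hw)
    have hL : ∀ x ∈ segment ℝ z w, ‖fderiv ℝ f x - fderiv ℝ f w‖ ≤ |B₂| * ‖w - z‖ := by
      intro x hx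
      refine (hconv.norm_image_sub_le_of_norm_fderiv_le
        (fun x _ => hf1.differentiable (by norm_num) x) hB₂ (mem w hw) (hseg hx)).trans ?_
      have h3 : ‖x - w‖ ≤ ‖w - z‖ := by
        have := norm_sub_le_of_mem_segment (segment_symm ℝ z w ▸ hx)
        rwa [norm_sub_rev z w] at this
      gcongr
      exact le_abs_self _
    have := (convex_segment z w).norm_image_sub_le_of_norm_hasFDerivWithin_le'
      (fun x _ => ((hf.differentiable (by norm_num) x).hasFDerivAt).hasFDerivWithinAt) hL
      (left_mem_segment ℝ z w) (right_mem_segment ℝ z w)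
    refine this.trans ?_
    rw [mul_assoc, ← sq]
    gcongr
    linarith

end HBVM

namespace HBVM

/-! ### Verification of the step relations -/

open Set Filter Topology

section StepPolynomial

variable {V : Type*} [NormedAddCommGroup V] [NormedSpace ℝ V]

/-- The solution `v + h ∑ j < s, (∫₀^τ P_j) g_j` of `p' = h ∑ j < s, P_j g_j`, `p 0 = v`. -/
noncomputable def stepPoly (s : ℕ) (h : ℝ) (v : V) (g : ℕ → V) (τ : ℝ) : V :=
  v + h • ∑ j ∈ Finset.range s, (∫ x in (0 : ℝ)..τ, (legendre j).eval x) • g j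

@[simp]
theorem stepPoly_zero (s : ℕ) (h : ℝ) (v : V) (g : ℕ → V) : stepPoly s h v g 0 = v := by
  simp [stepPoly]

theorem hasDerivAt_stepPoly (s : ℕ) (h : ℝ) (v : V) (g : ℕ → V) (τ : ℝ) :
    HasDerivAt (stepPoly s h v g)
      (h • ∑ j ∈ Finset.range s, (legendre j).eval τ • g j) τ := by
  have h1 : ∀ j ∈ Finset.range s, HasDerivAt
      (fun τ => (∫ x in (0 : ℝ)..τ, (legendre j).eval x) • g j) ((legendre j).eval τ • g j) τ :=
    fun j _ => ((legendre j).continuous.integral_hasStrictDerivAt 0 τ).hasDerivAt.smul_const _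
  exact ((HasDerivAt.fun_sum h1).fun_const_smul h).const_add v

theorem exists_stepPoly_eq_sum (s : ℕ) (h : ℝ) (v : V) (g : ℕ → V) :
    ∃ a : ℕ → V, ∀ τ, stepPoly s h v g τ = ∑ l ∈ Finset.range (s + 1), τ ^ l • a l := by
  refine ⟨fun l => match l with
    | 0 => v
    | l + 1 => h • ∑ j ∈ Finset.range s, ((legendre j).coeff l / ((l : ℝ) + 1)) • g j,
    fun τ => ?_⟩
  rw [Finset.sum_range_succ', stepPoly, add_comm]
  simp only [pow_zero, one_smul]
  congr 1
  have h1 : ∀ j ∈ Finset.range s, (∫ x in (0 : ℝ)..τ, (legendre j).eval x) • g j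
      = ∑ l ∈ Finset.range s, (τ ^ (l + 1) * ((legendre j).coeff l / ((l : ℝ) + 1))) • g j := by
    intro j hj
    rw [← Finset.sum_smul]
    congr 1
    have h2 : ∀ x : ℝ, (legendre j).eval x = ∑ l ∈ Finset.range s, (legendre j).coeff l * x ^ l :=
      fun x => Polynomial.eval_eq_sum_range' (by
        rw [natDegree_legendre]; exact Finset.mem_range.1 hj) x
    simp_rw [h2]
    rw [intervalIntegral.integral_finsetSum]
    · refine Finset.sum_congr rfl fun l _ => ?_
      rw [intervalIntegral.integral_const_mul, integral_pow]
      simp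
      ring
    · intro l _
      exact Continuous.intervalIntegrable (by fun_prop) _ _
  rw [Finset.sum_congr rfl h1, Finset.sum_comm, Finset.smul_sum]
  refine Finset.sum_congr rfl fun l _ => ?_
  rw [Finset.smul_sum, Finset.smul_sum, Finset.smul_sum]
  refine Finset.sum_congr rfl fun j _ => ?_
  simp_rw [smul_smul]
  congr 1
  ring

end StepPolynomial

variable {m k s K : ℕ}
  {f : EuclideanSpace ℝ (Fin m) × EuclideanSpace ℝ (Fin m) → EuclideanSpace ℝ (Fin m)}
  {y₀ : EuclideanSpace ℝ (Fin m)} {y : ℝ → EuclideanSpace ℝ (Fin m)} {c b : Fin k → ℝ}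

/-- `u` is computed by the first `N` steps of the method, starting from `y₀`. -/
structure IsHBVMSteps
    (f : EuclideanSpace ℝ (Fin m) × EuclideanSpace ℝ (Fin m) → EuclideanSpace ℝ (Fin m))
    (y₀ : EuclideanSpace ℝ (Fin m)) (N ν s : ℕ) (c b : Fin k → ℝ)
    (u : ℝ → EuclideanSpace ℝ (Fin m)) : Prop where
  initial : u 0 = y₀
  hasDeriv : ∀ n : ℕ, n < N → ∀ τ ∈ Icc (0 : ℝ) 1,
    HasDerivWithinAt u
      (∑ j ∈ Finset.range s, (legendre j).eval τ • fourierCoeff f c b ν u n j)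
      (Icc ((n : ℝ) / ν) (((n : ℝ) + 1) / ν)) (((n : ℝ) + τ) / ν)

theorem isHBVMApprox_iff {ν : ℕ} {u : ℝ → EuclideanSpace ℝ (Fin m)} :
    IsHBVMApprox f y₀ K ν s c b u ↔ IsHBVMSteps f y₀ (K * ν) ν s c b u :=
  ⟨fun h => ⟨h.1, h.2⟩, fun h => ⟨h.1, h.2⟩⟩

theorem natCast_div_le_and_le {n ν : ℕ} (hν : 1 ≤ ν) :
    ((n / ν : ℕ) : ℝ) ≤ (n : ℝ) / ν ∧ ((n : ℝ) + 1) / ν ≤ ((n / ν : ℕ) : ℝ) + 1 := by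
  have hν' : (0 : ℝ) < ν := by exact_mod_cast hν
  refine ⟨Nat.cast_div_le, ?_⟩
  rw [div_le_iff₀ hν']
  have h1 := Nat.div_add_mod n ν
  have h2 := Nat.mod_lt n hν
  have : n + 1 ≤ (n / ν + 1) * ν := by rw [add_mul, mul_comm (n / ν)]; omega
  exact_mod_cast this

theorem mem_Icc_step {n ν : ℕ} (hν : 1 ≤ ν) {τ : ℝ} (hτ : τ ∈ Icc (0 : ℝ) 1) :
    ((n : ℝ) + τ) / ν ∈ Icc ((n : ℝ) / ν) (((n : ℝ) + 1) / ν) := by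
  have hν' : (0 : ℝ) < ν := by exact_mod_cast hν
  constructor <;> gcongr
  · linarith [hτ.1]
  · exact hτ.2

/-- On each step the approximation is the polynomial determined by its initial value and its Fourier
coefficients. -/
theorem IsHBVMSteps.eq_stepPoly {N ν : ℕ} (hν : 1 ≤ ν) {u : ℝ → EuclideanSpace ℝ (Fin m)}
    (hu : IsHBVMSteps f y₀ N ν s c b u) {n : ℕ} (hn : n < N) {τ : ℝ} (hτ : τ ∈ Icc (0 : ℝ) 1) :
    u (((n : ℝ) + τ) / ν)
      = stepPoly s (1 / ν) (u ((n : ℝ) / ν)) (fourierCoeff f c b ν u n) τ := by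
  have hd : ∀ σ ∈ Icc (0 : ℝ) 1, HasDerivWithinAt (fun σ => u (((n : ℝ) + σ) / ν)
      - stepPoly s (1 / ν) (u ((n : ℝ) / ν)) (fourierCoeff f c b ν u n) σ) 0 (Icc 0 1) σ := by
    intro σ hσ
    have h1 : HasDerivWithinAt (fun σ : ℝ => ((n : ℝ) + σ) / ν) (1 / ν) (Icc 0 1) σ :=
      (((hasDerivAt_id σ).const_add (n : ℝ)).div_const (ν : ℝ)).hasDerivWithinAt
    have h2 := (hu.hasDeriv n hn σ hσ).scomp σ h1 (fun x hx => mem_Icc_step hν hx)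
    have h3 := h2.sub (hasDerivAt_stepPoly s (1 / (ν : ℝ)) (u ((n : ℝ) / ν))
      (fourierCoeff f c b ν u n) σ).hasDerivWithinAt
    rw [sub_self] at h3
    exact h3
  have := norm_image_sub_le_of_norm_deriv_le_segment' hd (C := 0) (by simp) τ hτ
  simpa [sub_eq_zero] using this

/-- A Taylor bound on a unit interval, in the scaled time of a step contained in it. -/
theorem HasTaylorBound.scaled {V : Type*} [NormedAddCommGroup V] [NormedSpace ℝ V] {φ : ℝ → V}
    {n ν r : ℕ} {C : ℝ} (hν : 1 ≤ ν) (hC : 0 ≤ C)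
    (h : HasTaylorBound φ ((n / ν : ℕ) : ℝ) (((n / ν : ℕ) : ℝ) + 1) r C) :
    ∃ v : ℕ → V, (∀ l < r, ‖v l‖ ≤ C) ∧ ∀ p ≤ r, ∀ τ ∈ Icc (0 : ℝ) 1,
      ‖φ (((n : ℝ) + τ) / ν) - ∑ l ∈ Finset.range p, ((1 / (ν : ℝ)) * τ) ^ l • v l‖
        ≤ C * (1 / (ν : ℝ)) ^ p := by
  have hν' : (0 : ℝ) < ν := by exact_mod_cast hν
  obtain ⟨h1, h2⟩ := natCast_div_le_and_le (n := n) hν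
  have h3 : (n : ℝ) / ν < ((n : ℝ) + 1) / ν := by gcongr; linarith
  obtain ⟨v, hv, hr⟩ := h ((n : ℝ) / ν) ⟨h1, h3.trans_le h2⟩
  refine ⟨v, hv, fun p hp τ hτ => ?_⟩
  have hmem := mem_Icc_step (n := n) hν hτ
  have h4 := hr p hp (((n : ℝ) + τ) / ν) ⟨hmem.1, hmem.2.trans h2⟩
  have h5 : ((n : ℝ) + τ) / ν - (n : ℝ) / ν = (1 / (ν : ℝ)) * τ := by ring
  rw [h5] at h4
  refine h4.trans ?_
  have h6 : (0 : ℝ) ≤ 1 / ν := by positivity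
  have h7 := hτ.1
  gcongr
  exact mul_le_of_le_one_right h6 hτ.2

/-- A uniform bound for the kernel of the discrete Legendre projection. -/
theorem exists_kernel_bound (s : ℕ) (c b : Fin k → ℝ) :
    ∃ κ : ℝ, 0 ≤ κ ∧ ∀ τ ∈ Icc (0 : ℝ) 1,
      ∑ j ∈ Finset.range s, ∑ i, |(legendre j).eval τ * (b i * (legendre j).eval (c i))| ≤ κ := by
  obtain ⟨κ, hκ⟩ := (isCompact_Icc (a := (0 : ℝ)) (b := 1)).exists_bound_of_continuousOn
    (f := fun τ => ∑ j ∈ Finset.range s, ∑ i,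
      |(legendre j).eval τ * (b i * (legendre j).eval (c i))|) (by
      refine Continuous.continuousOn ?_
      fun_prop)
  exact ⟨κ, (norm_nonneg _).trans (hκ 0 (by simp)), fun τ hτ => (le_abs_self _).trans (hκ τ hτ)⟩

/-- The discrete Legendre projection of values bounded by `B`. -/
theorem norm_projection_le {V : Type*} [NormedAddCommGroup V] [NormedSpace ℝ V] {κ B τ : ℝ}
    (hκ : ∑ j ∈ Finset.range s, ∑ i, |(legendre j).eval τ * (b i * (legendre j).eval (c i))| ≤ κ)
    (hB : 0 ≤ B) {v : Fin k → V} (hv : ∀ i, ‖v i‖ ≤ B) :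
    ‖∑ j ∈ Finset.range s, (legendre j).eval τ • ∑ i, (b i * (legendre j).eval (c i)) • v i‖
      ≤ κ * B := by
  refine le_trans ?_ (mul_le_mul_of_nonneg_right hκ hB)
  rw [Finset.sum_mul]
  refine norm_sum_le_of_le _ fun j _ => ?_
  rw [Finset.sum_mul, Finset.smul_sum]
  refine norm_sum_le_of_le _ fun i _ => ?_
  rw [smul_smul, norm_smul, Real.norm_eq_abs]
  exact mul_le_mul_of_nonneg_left (hv i) (abs_nonneg _)

/-- The error of each step of a bounded approximation satisfies the relations `StepError`, with a
constant that depends on neither the stepsize nor the approximation. -/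
theorem exists_stepError {q : ℕ} (hs : 1 ≤ s)
    (hf : ContDiff ℝ ((2 * s : ℕ) : WithTop ℕ∞) f) (hy : IsFDEPCASolution f y₀ K y)
    (hc : ∀ i, c i ∈ Icc (0 : ℝ) 1) (hq : HasQuadratureOrder c b q) (hqs : 2 * s ≤ q)
    {R : ℝ} (hR : ∀ t ∈ Icc (0 : ℝ) K, ‖y t‖ ≤ R) :
    ∃ C, ∀ ν N : ℕ, 1 ≤ ν → N ≤ K * ν → ∀ u, IsHBVMSteps f y₀ N ν s c b u →
      (∀ t ∈ Icc (0 : ℝ) ((N : ℝ) / ν), ‖u t‖ ≤ R) → ∀ n < N, ∀ δ ≤ 2 * R,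
      ‖y ((n : ℝ) / ν) - u ((n : ℝ) / ν)‖ ≤ δ →
      ‖y ((n / ν : ℕ) : ℝ) - u ((n / ν : ℕ) : ℝ)‖ ≤ δ →
      ∃ w F, StepError s c b C (1 / ν) δ
        (fun τ => y (((n : ℝ) + τ) / ν) - u (((n : ℝ) + τ) / ν)) w F := by
  have hR0 : 0 ≤ R := (norm_nonneg _).trans (hR 0 ⟨le_rfl, Nat.cast_nonneg K⟩)
  have hyC := fun κ (hκ : κ < K) => hy.contDiffOn hf hκ
  have hy2 : ∀ κ < K, ContDiffOn ℝ (2 * s : ℕ) y (Icc (κ : ℝ) (κ + 1)) := fun κ hκ =>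
    (hyC κ hκ).of_le (by exact_mod_cast Nat.le_succ _)
  have hpair : ∀ κ < K, ContDiffOn ℝ (2 * s : ℕ) (fun t => (y t, y κ)) (Icc (κ : ℝ) (κ + 1)) :=
    fun κ hκ => (hy2 κ hκ).prodMk contDiffOn_const
  have hf' : ContDiff ℝ s (fderiv ℝ f) := hf.fderiv_right (by exact_mod_cast (by omega))
  obtain ⟨CG, hCG0, hCG⟩ := exists_hasTaylorBound_forall_lt (φ := fun κ t => f (y t, y κ))
    (fun κ hκ => hf.comp_contDiffOn (hpair κ hκ))
  obtain ⟨CY, hCY0, hCY⟩ := exists_hasTaylorBound_forall_lt (φ := fun _ => y) hy2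
  obtain ⟨CA, hCA0, hCA⟩ := exists_hasTaylorBound_forall_lt (n := s) (K := K)
    (φ := fun κ t => (fderiv ℝ f (y t, y κ)).comp
      (ContinuousLinearMap.inl ℝ (EuclideanSpace ℝ (Fin m)) (EuclideanSpace ℝ (Fin m))))
    (fun κ hκ => (hf'.comp_contDiffOn ((hpair κ hκ).of_le
      (by exact_mod_cast (by omega)))).clm_comp contDiffOn_const)
  obtain ⟨B, hB0, hB, hBf⟩ := exists_bounds_on_closedBall (hf.of_le (m := 2)
    (by exact_mod_cast (by omega))) R
  obtain ⟨κ, hκ0, hκ⟩ := exists_kernel_bound s c b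
  set β : ℝ := ∑ i, |b i| with hβ
  have hβ0 : 0 ≤ β := Finset.sum_nonneg fun _ _ => abs_nonneg _
  set C : ℝ := 1 + β + 2 * R + (CG + κ * CG + κ * B) + (1 + β) * CG + (1 + β) * CY
    + B * (2 * R + 1) + CA with hC
  have hp1 : 0 ≤ κ * CG := by positivity
  have hp2 : 0 ≤ κ * B := by positivity
  have hp3 : 0 ≤ (1 + β) * CG := by positivity
  have hp4 : 0 ≤ (1 + β) * CY := by positivity
  have hp5 : 0 ≤ B * R := by positivity
  refine ⟨C, fun ν N hν hN u hu huR n hn δ hδ hδ0 hδκ => ?_⟩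
  have hν' : (0 : ℝ) < ν := by exact_mod_cast hν
  have hδ' : 0 ≤ δ := (norm_nonneg _).trans hδ0
  have hκK : n / ν < K := by
    rw [Nat.div_lt_iff_lt_mul hν]
    omega
  obtain ⟨hn1, hn2⟩ := natCast_div_le_and_le (n := n) hν
  have hκK' : ((n / ν : ℕ) : ℝ) + 1 ≤ K := by exact_mod_cast hκK
  have hκ00 : (0 : ℝ) ≤ ((n / ν : ℕ) : ℝ) := Nat.cast_nonneg _
  have hnN : ((n : ℝ) + 1) / ν ≤ (N : ℝ) / ν := by
    gcongr
    exact_mod_cast hn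
  have hmemκ : ∀ τ ∈ Icc (0 : ℝ) 1,
      ((n : ℝ) + τ) / ν ∈ Icc ((n / ν : ℕ) : ℝ) (((n / ν : ℕ) : ℝ) + 1) := fun τ hτ =>
    ⟨hn1.trans (mem_Icc_step hν hτ).1, (mem_Icc_step hν hτ).2.trans hn2⟩
  have hYR : ∀ τ ∈ Icc (0 : ℝ) 1, ‖y (((n : ℝ) + τ) / ν)‖ ≤ R := fun τ hτ =>
    hR _ ⟨hκ00.trans (hmemκ τ hτ).1, (hmemκ τ hτ).2.trans hκK'⟩
  have hUR : ∀ τ ∈ Icc (0 : ℝ) 1, ‖u (((n : ℝ) + τ) / ν)‖ ≤ R := fun τ hτ =>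
    huR _ ⟨hκ00.trans (hmemκ τ hτ).1, (mem_Icc_step hν hτ).2.trans hnN⟩
  have hYκ : ‖y ((n / ν : ℕ) : ℝ)‖ ≤ R := hR _ ⟨hκ00, by linarith⟩
  have hUκ : ‖u ((n / ν : ℕ) : ℝ)‖ ≤ R := huR _ ⟨hκ00, hn1.trans (le_trans (by
    gcongr; linarith) hnN)⟩
  obtain ⟨vG, -, hG⟩ := (hCG _ hκK).scaled hν hCG0
  obtain ⟨vY, -, hY⟩ := (hCY _ hκK).scaled hν hCY0
  obtain ⟨vA, hvA, hA⟩ := (hCA _ hκK).scaled hν hCA0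
  set h : ℝ := 1 / (ν : ℝ) with hh
  have hh0 : 0 < h := by positivity
  have hh1 : h ≤ 1 := by
    rw [hh, div_le_one hν']
    exact_mod_cast hν
  set κn : ℝ := ((n / ν : ℕ) : ℝ) with hκn
  set e : ℝ → EuclideanSpace ℝ (Fin m) :=
    fun τ => y (((n : ℝ) + τ) / ν) - u (((n : ℝ) + τ) / ν) with he
  set G : ℝ → EuclideanSpace ℝ (Fin m) := fun τ => f (y (((n : ℝ) + τ) / ν), y κn) with hGdef
  set g : ℕ → EuclideanSpace ℝ (Fin m) := fourierCoeff f c b ν u n with hg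
  set w : ℝ → EuclideanSpace ℝ (Fin m) :=
    fun τ => G τ - ∑ j ∈ Finset.range s, (legendre j).eval τ • g j with hw
  set F : ℝ → EuclideanSpace ℝ (Fin m) :=
    fun τ => G τ - f (u (((n : ℝ) + τ) / ν), u κn) with hF
  have hd : ∀ τ ∈ Icc (0 : ℝ) 1, HasDerivWithinAt e (h • w τ) (Icc 0 1) τ := by
    intro τ hτ
    have h1 : HasDerivWithinAt (fun σ : ℝ => ((n : ℝ) + σ) / ν) h (Icc 0 1) τ :=
      (((hasDerivAt_id τ).const_add (n : ℝ)).div_const (ν : ℝ)).hasDerivWithinAt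
    have h2 := (hu.hasDeriv n hn τ hτ).scomp τ h1 (fun x hx => mem_Icc_step hν hx)
    have h3 := (hy.hasDerivWithinAt_Icc hf.continuous hκK (hmemκ τ hτ)).scomp τ h1
      (fun x hx => hmemκ x hx)
    have h4 := h3.sub h2
    rw [← smul_sub] at h4
    exact h4
  have hτcont : ContinuousOn (fun τ : ℝ => y (((n : ℝ) + τ) / ν)) (Icc 0 1) :=
    ContinuousOn.comp (hy2 _ hκK).continuousOn (by fun_prop) hmemκ
  have hGcont : ContinuousOn G (Icc 0 1) :=
    hf.continuous.comp_continuousOn (hτcont.prodMk continuousOn_const)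
  have hwcont : ContinuousOn w (Icc 0 1) := by
    refine hGcont.sub (Continuous.continuousOn ?_)
    fun_prop
  have hecont : ContinuousOn e (Icc 0 1) := fun τ hτ => (hd τ hτ).continuousWithinAt
  -- consequences of the bounds for `f` on the ball of radius `R`
  have hprod : ∀ a b : EuclideanSpace ℝ (Fin m), ‖a‖ ≤ R → ‖b‖ ≤ R → ‖(a, b)‖ ≤ R :=
    fun a b ha hb => max_le ha hb
  have hFle : ∀ τ ∈ Icc (0 : ℝ) 1, ‖F τ‖ ≤ B * (‖e τ‖ + δ) := by
    intro τ hτ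
    refine (hBf _ _ (hprod _ _ (hYR τ hτ) hYκ) (hprod _ _ (hUR τ hτ) hUκ)).1.trans ?_
    gcongr
    refine max_le ?_ ?_
    · exact le_add_of_nonneg_right hδ'
    · exact hδκ.trans (le_add_of_nonneg_left (norm_nonneg _))
  refine ⟨w, F, by linarith, hc, by linarith, hh0, hh1, hδ', by linarith, hd, hwcont,
    by simpa [he] using hδ0, ?_, ?_, ?_, ?_⟩
  · intro M hM τ hτ
    set T : ℝ → EuclideanSpace ℝ (Fin m) :=
      fun τ => ∑ l ∈ Finset.range s, (h * τ) ^ l • vG l with hT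
    have hTG : ∀ τ ∈ Icc (0 : ℝ) 1, ‖G τ - T τ‖ ≤ CG * h ^ s := hG s (by omega)
    -- the discrete projection reproduces the Taylor polynomial
    have hproj : ∑ j ∈ Finset.range s,
        (legendre j).eval τ • ∑ i, (b i * (legendre j).eval (c i)) • T (c i) = T τ := by
      have h1 : ∀ l ∈ Finset.range s, (h * τ) ^ l • vG l = ∑ j ∈ Finset.range s,
          (legendre j).eval τ • ∑ i, (b i * (legendre j).eval (c i)) • (h * c i) ^ l • vG l := by
        intro l hl
        rw [mul_pow, ← hq.sum_legendre_mul_pow hqs (Finset.mem_range.1 hl) τ, Finset.mul_sum,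
          Finset.sum_smul]
        refine Finset.sum_congr rfl fun j _ => ?_
        simp_rw [smul_smul]
        rw [← Finset.sum_smul, smul_smul, mul_left_comm, Finset.mul_sum]
        congr 2
        exact Finset.sum_congr rfl fun i _ => by ring
      simp only [hT]
      rw [Finset.sum_congr rfl h1, Finset.sum_comm]
      refine Finset.sum_congr rfl fun j _ => ?_
      rw [← Finset.smul_sum, Finset.sum_comm]
      simp_rw [Finset.smul_sum]
    have hweq : w τ = (G τ - T τ) + ∑ j ∈ Finset.range s, (legendre j).eval τ •
        ∑ i, (b i * (legendre j).eval (c i)) • ((F (c i)) - (G (c i) - T (c i))) := by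
      have h1 : ∑ j ∈ Finset.range s, (legendre j).eval τ •
          ∑ i, (b i * (legendre j).eval (c i)) • ((F (c i)) - (G (c i) - T (c i)))
          = T τ - ∑ j ∈ Finset.range s, (legendre j).eval τ • g j := by
        rw [← hproj, ← Finset.sum_sub_distrib]
        refine Finset.sum_congr rfl fun j _ => ?_
        rw [← smul_sub, hg, fourierCoeff, ← Finset.sum_sub_distrib]
        congr 1
        refine Finset.sum_congr rfl fun i _ => ?_
        rw [← smul_sub]
        congr 1
        simp only [hF]
        abel
      rw [h1]
      simp only [hw]
      abel
    -- a quadrature formula without nodes is not exact for constants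
    rcases isEmpty_or_nonempty (Fin k) with hk | ⟨⟨i₀⟩⟩
    · exfalso
      have := hq.sum_pow (l := 0) (by omega)
      simp at this
    have hM0 : 0 ≤ M := (norm_nonneg _).trans (hM i₀)
    have h2 := norm_projection_le (hκ τ hτ) (B := B * (M + δ) + CG * h ^ s) (by positivity)
      (v := fun i => F (c i) - (G (c i) - T (c i))) (fun i => by
        refine (norm_sub_le _ _).trans (add_le_add ((hFle _ (hc i)).trans ?_) (hTG _ (hc i)))
        gcongr
        exact hM i)
    rw [hweq]
    refine (norm_add_le _ _).trans ((add_le_add (hTG τ hτ) h2).trans ?_)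
    have hhs : 0 ≤ h ^ s := by positivity
    have h3 : (CG + κ * CG + κ * B) * (h ^ s + M + δ) ≤ C * (h ^ s + M + δ) := by
      gcongr
      have : 0 ≤ B * (2 * R + 1) := by positivity
      linarith
    have h4 : 0 ≤ (CG + κ * CG) * (M + δ) := by positivity
    have h5 : 0 ≤ κ * B * h ^ s := by positivity
    linarith
  · intro r d hr hd0
    have h1 := hq.norm_integral_sub_sum_le hc (r := r) (p := s + d) (by omega) hGcont
      (fun l => h ^ l • vG l) (ε := CG * h ^ (s + d)) (fun τ hτ => by
        have := hG (s + d) (by omega) τ hτ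
        refine le_trans (le_of_eq ?_) this
        congr 2
        refine Finset.sum_congr rfl fun l _ => ?_
        rw [smul_smul, mul_pow, mul_comm])
    have hint : (∫ τ in (0 : ℝ)..1, τ ^ r • w τ) = (∫ τ in (0 : ℝ)..1, τ ^ r • G τ)
        - ∑ i, (b i * c i ^ r) • f (u (((n : ℝ) + c i) / ν), u κn) := by
      have h2 : (∫ τ in (0 : ℝ)..1, τ ^ r • ∑ j ∈ Finset.range s, (legendre j).eval τ • g j)
          = ∑ i, (b i * c i ^ r) • f (u (((n : ℝ) + c i) / ν), u κn) := by
        simp_rw [Finset.smul_sum, smul_smul]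
        rw [intervalIntegral.integral_finsetSum]
        · simp_rw [intervalIntegral.integral_smul_const, hg, fourierCoeff, Finset.smul_sum]
          rw [Finset.sum_comm]
          refine Finset.sum_congr rfl fun i _ => ?_
          simp_rw [smul_smul]
          rw [← Finset.sum_smul]
          congr 1
          rw [← sum_integral_pow_mul_legendre (show r < s by omega) (c i), Finset.mul_sum]
          exact Finset.sum_congr rfl fun j _ => by ring
        · intro j _
          exact Continuous.intervalIntegrable (by fun_prop) _ _
      rw [← h2, ← intervalIntegral.integral_sub]
      · simp_rw [hw, smul_sub]
      · refine ContinuousOn.intervalIntegrable ?_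
        rw [Set.uIcc_of_le zero_le_one]
        fun_prop
      · exact Continuous.intervalIntegrable (by fun_prop) _ _
    have h3 : (∫ τ in (0 : ℝ)..1, τ ^ r • w τ) - ∑ i, (b i * c i ^ r) • F (c i)
        = (∫ τ in (0 : ℝ)..1, τ ^ r • G τ) - ∑ i, (b i * c i ^ r) • G (c i) := by
      simp_rw [hint, hF, smul_sub, Finset.sum_sub_distrib]
      abel
    rw [h3]
    refine h1.trans ?_
    rw [← mul_assoc]
    gcongr
    have : 0 ≤ B * (2 * R + 1) := by positivity
    linarith
  · intro r d hr hd0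
    obtain ⟨a, ha⟩ := exists_stepPoly_eq_sum s h (u ((n : ℝ) / ν)) g
    have h1 := hq.norm_integral_sub_sum_le hc (r := r) (p := s + d) (by omega) hecont
      (fun l => h ^ l • vY l - if l < s + 1 then a l else 0) (ε := CY * h ^ (s + d))
      (fun τ hτ => by
        have h2 := hY (s + d) (by omega) τ hτ
        refine le_trans (le_of_eq ?_) h2
        have h3 : ∑ l ∈ Finset.range (s + d), τ ^ l • (if l < s + 1 then a l else 0)
            = u (((n : ℝ) + τ) / ν) := by
          rw [hu.eq_stepPoly hν hn hτ, ha]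
          simp_rw [smul_ite, smul_zero]
          rw [← Finset.sum_filter]
          refine Finset.sum_congr ?_ fun _ _ => rfl
          ext l
          simp only [Finset.mem_filter, Finset.mem_range]
          omega
        have h4 : ∑ l ∈ Finset.range (s + d), τ ^ l • h ^ l • vY l
            = ∑ l ∈ Finset.range (s + d), (h * τ) ^ l • vY l :=
          Finset.sum_congr rfl fun l _ => by rw [smul_smul, mul_pow, mul_comm]
        simp_rw [smul_sub, Finset.sum_sub_distrib]
        rw [h3, h4]
        congr 1
        simp only [he]
        abel)
    refine h1.trans ?_
    rw [← mul_assoc]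
    gcongr
    have : 0 ≤ B * (2 * R + 1) := by positivity
    linarith
  · refine ⟨fun τ => (fderiv ℝ f (y (((n : ℝ) + τ) / ν), y κn)).comp
      (ContinuousLinearMap.inl ℝ (EuclideanSpace ℝ (Fin m)) (EuclideanSpace ℝ (Fin m))), vA,
      fun i => ?_, fun l hl => (hvA l hl).trans ?_, fun p hp i => (hA p hp _ (hc i)).trans ?_⟩
    · have hw1 := hprod _ _ (hYR _ (hc i)) hYκ
      have hz1 := hprod _ _ (hUR _ (hc i)) hUκ
      have h1 := (hBf _ _ hw1 hz1).2
      have h2 := (hB _ hw1).2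
      set w₁ := (y (((n : ℝ) + c i) / ν), y κn) with hw₁
      set z₁ := (u (((n : ℝ) + c i) / ν), u κn) with hz₁
      have h3 : w₁ - z₁ = ContinuousLinearMap.inl ℝ _ _ (e (c i)) + (0, y κn - u κn) := by
        simp [hw₁, hz₁, he]
      have h4 : F (c i) - fderiv ℝ f w₁ (ContinuousLinearMap.inl ℝ _ _ (e (c i)))
          = (f w₁ - f z₁ - fderiv ℝ f w₁ (w₁ - z₁)) + fderiv ℝ f w₁ (0, y κn - u κn) := by
        rw [h3, map_add]
        simp only [hF, hGdef, hw₁, hz₁]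
        abel
      have h5 : ‖fderiv ℝ f w₁ (0, y κn - u κn)‖ ≤ B * δ := by
        refine (ContinuousLinearMap.le_opNorm _ _).trans ?_
        gcongr
        exact max_le (by simpa using hδ') hδκ
      have h6 : ‖w₁ - z₁‖ ^ 2 ≤ ‖e (c i)‖ ^ 2 + 2 * R * δ := by
        have h7 : δ ^ 2 ≤ 2 * R * δ := by rw [sq]; gcongr
        have h8 : ‖w₁ - z₁‖ ≤ max ‖e (c i)‖ δ := max_le_max le_rfl hδκ
        have h9 : ‖w₁ - z₁‖ ^ 2 ≤ (max ‖e (c i)‖ δ) ^ 2 := by gcongr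
        have h10 : 0 ≤ 2 * R * δ := by positivity
        have h11 := sq_nonneg ‖e (c i)‖
        rcases max_choice ‖e (c i)‖ δ with h | h <;> rw [h] at h9 <;> linarith
      rw [ContinuousLinearMap.comp_apply, h4]
      calc _ ≤ B * (‖e (c i)‖ ^ 2 + 2 * R * δ) + B * δ := by
            refine (norm_add_le _ _).trans (add_le_add (h1.trans ?_) h5)
            gcongr
        _ ≤ B * (2 * R + 1) * (‖e (c i)‖ ^ 2 + δ) := by
            have : 0 ≤ B * R * ‖e (c i)‖ ^ 2 := by positivity
            linarith
        _ ≤ _ := by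
            gcongr
            linarith
    · have : 0 ≤ B * (2 * R + 1) := by positivity
      linarith
    · have : 0 ≤ B * (2 * R + 1) := by positivity
      gcongr
      linarith

end HBVM

namespace HBVM

/-! ### Global error, existence and uniqueness -/

open Set Filter Topology

variable {m k s K q : ℕ}
  {f : EuclideanSpace ℝ (Fin m) × EuclideanSpace ℝ (Fin m) → EuclideanSpace ℝ (Fin m)}
  {y₀ : EuclideanSpace ℝ (Fin m)} {y : ℝ → EuclideanSpace ℝ (Fin m)} {c b : Fin k → ℝ}

/-- The error estimates for all small stepsizes, also for approximations that are only known on an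
initial part of `[0, K]`. -/
theorem exists_error_bound (hs : 1 ≤ s)
    (hf : ContDiff ℝ ((2 * s : ℕ) : WithTop ℕ∞) f) (hy : IsFDEPCASolution f y₀ K y)
    (hc : ∀ i, c i ∈ Icc (0 : ℝ) 1) (hq : HasQuadratureOrder c b q) (hqs : 2 * s ≤ q)
    {R : ℝ} (hR : ∀ t ∈ Icc (0 : ℝ) K, ‖y t‖ ≤ R) :
    ∃ (D : ℝ) (ν₀ : ℕ), 0 ≤ D ∧ ∀ ν N : ℕ, ν₀ ≤ ν → 1 ≤ ν → N ≤ K * ν → ∀ u,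
      IsHBVMSteps f y₀ N ν s c b u → (∀ t ∈ Icc (0 : ℝ) ((N : ℝ) / ν), ‖u t‖ ≤ R) →
      (∀ n ≤ N, ‖y ((n : ℝ) / ν) - u ((n : ℝ) / ν)‖ ≤ D * (1 / (ν : ℝ)) ^ (2 * s)) ∧
      ∀ n < N,
        ‖(y (((n : ℝ) + 1) / ν) - u (((n : ℝ) + 1) / ν)) - (y ((n : ℝ) / ν) - u ((n : ℝ) / ν))‖
          ≤ D * (1 / (ν : ℝ)) ^ (2 * s + 1) ∧
        ∀ τ ∈ Icc (0 : ℝ) 1, ‖y (((n : ℝ) + τ) / ν) - u (((n : ℝ) + τ) / ν)‖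
          ≤ D * (1 / (ν : ℝ)) ^ (s + 1) := by
  obtain ⟨C, hC⟩ := exists_stepError hs hf hy hc hq hqs hR
  obtain ⟨D, h₀, hD, hh₀, hstep⟩ :=
    StepError.exists_norm_increment_le (V := EuclideanSpace ℝ (Fin m)) k s C
  set E : ℝ := Real.exp (D * K) with hE
  refine ⟨E + D * (E + 1), ⌈1 / h₀⌉₊, by positivity, fun ν N hν₀ hν hN u hu huR => ?_⟩
  have hν' : (0 : ℝ) < ν := by exact_mod_cast hν
  set h : ℝ := 1 / (ν : ℝ) with hh
  have hh0 : 0 < h := by positivity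
  have hh1 : h ≤ 1 := by
    rw [hh, div_le_one hν']
    exact_mod_cast hν
  have hhh₀ : h ≤ h₀ := by
    rw [hh, div_le_comm₀ hν' hh₀]
    exact Nat.ceil_le.1 hν₀
  set err : ℕ → EuclideanSpace ℝ (Fin m) := fun n => y ((n : ℝ) / ν) - u ((n : ℝ) / ν) with herr
  have hNK : (N : ℝ) / ν ≤ K := by
    rw [div_le_iff₀ hν']
    exact_mod_cast hN
  have herr2R : ∀ n ≤ N, ‖err n‖ ≤ 2 * R := fun n hn => by
    have h1 : (n : ℝ) / ν ≤ (N : ℝ) / ν := by gcongr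
    have h2 : (0 : ℝ) ≤ (n : ℝ) / ν := by positivity
    refine (norm_sub_le _ _).trans ?_
    linarith [hR _ ⟨h2, h1.trans hNK⟩, huR _ ⟨h2, h1⟩]
  have hmem : ∀ n : ℕ, ((n / ν : ℕ) : ℝ) = ((n / ν * ν : ℕ) : ℝ) / ν := fun n => by
    push_cast
    field_simp
  -- one step, with the errors of the preceding steps bounded by `X`
  have hloc : ∀ n < N, ∀ X, (∀ i ≤ n, ‖err i‖ ≤ X) →
      ‖err (n + 1) - err n‖ ≤ D * (h * X + h ^ (2 * s + 1)) ∧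
      ∀ τ ∈ Icc (0 : ℝ) 1, ‖y (((n : ℝ) + τ) / ν) - u (((n : ℝ) + τ) / ν)‖
          ≤ D * (X + h ^ (s + 1)) := by
    intro n hn X hX
    have hi : n / ν * ν ≤ n := Nat.div_mul_le_self n ν
    set δ := max ‖err n‖ ‖err (n / ν * ν)‖ with hδ
    have hδX : δ ≤ X := max_le (hX n le_rfl) (hX _ hi)
    obtain ⟨w, F, H⟩ := hC ν N hν hN u hu huR n hn δ
      (max_le (herr2R n hn.le) (herr2R _ (hi.trans hn.le))) (le_max_left _ _)
      (by rw [hmem]; exact le_max_right _ _)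
    obtain ⟨h1, h2⟩ := hstep c b h δ _ w F H hhh₀
    constructor
    · have h3 : err (n + 1) - err n = (y (((n : ℝ) + 1) / ν) - u (((n : ℝ) + 1) / ν))
          - (y (((n : ℝ) + 0) / ν) - u (((n : ℝ) + 0) / ν)) := by
        simp [herr]
      rw [h3]
      refine h1.trans ?_
      gcongr
    · intro τ hτ
      refine (h2 τ hτ).trans ?_
      gcongr
  -- the discrete Gronwall inequality
  have hgron : ∀ n ≤ N, ∀ i ≤ n, ‖err i‖ ≤ h ^ (2 * s) * ((1 + D * h) ^ n - 1) := by
    intro n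
    induction n with
    | zero =>
      intro _ i hi
      obtain rfl : i = 0 := by omega
      simp [herr, hu.initial, hy.initial]
    | succ n ih =>
      intro hn i hi
      have ih' := ih (by omega)
      have hp : 0 ≤ h ^ (2 * s) := by positivity
      have hq1 : 0 ≤ D * h := by positivity
      rcases Nat.lt_or_ge n i with hlt | hge
      · obtain rfl : i = n + 1 := by omega
        have h1 := (hloc n (by omega) _ ih').1
        have h2 : ‖err (n + 1)‖ ≤ ‖err n‖ + ‖err (n + 1) - err n‖ := by
          simpa using norm_add_le (err n) (err (n + 1) - err n)
        have h3 := ih' n le_rfl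
        have h4 : h ^ (2 * s) * ((1 + D * h) ^ (n + 1) - 1)
            = h ^ (2 * s) * ((1 + D * h) ^ n - 1)
              + D * (h * (h ^ (2 * s) * ((1 + D * h) ^ n - 1)) + h ^ (2 * s + 1)) := by ring
        rw [h4]
        linarith
      · refine (ih' i hge).trans ?_
        gcongr
        · linarith
        · omega
  have hexp : ∀ n ≤ N, (1 + D * h) ^ n ≤ E := by
    intro n hn
    have h1 : 1 + D * h ≤ Real.exp (D * h) := by linarith [Real.add_one_le_exp (D * h)]
    calc (1 + D * h) ^ n ≤ (Real.exp (D * h)) ^ n := by gcongr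
      _ = Real.exp (D * ((n : ℝ) / ν)) := by
        rw [← Real.exp_nat_mul]
        congr 1
        rw [hh]; ring
      _ ≤ E := by
        rw [hE]
        gcongr
        refine le_trans ?_ hNK
        gcongr
  have hX : ∀ n ≤ N, ‖err n‖ ≤ E * h ^ (2 * s) := fun n hn => by
    refine (hgron n hn n le_rfl).trans ?_
    rw [mul_comm]
    gcongr
    linarith [hexp n hn]
  have hE0 : 0 ≤ E := (Real.exp_pos _).le
  have hDE : 0 ≤ D * (E + 1) := by positivity
  refine ⟨fun n hn => (hX n hn).trans ?_, fun n hn => ?_⟩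
  · gcongr
    linarith
  obtain ⟨h1, h2⟩ := hloc n hn (E * h ^ (2 * s)) (fun i hi => hX i (by omega))
  refine ⟨?_, fun τ hτ => (h2 τ hτ).trans ?_⟩
  · have h3 : err (n + 1) - err n = (y (((n : ℝ) + 1) / ν) - u (((n : ℝ) + 1) / ν))
          - (y ((n : ℝ) / ν) - u ((n : ℝ) / ν)) := by
      simp [herr]
    rw [← h3]
    refine h1.trans ?_
    have h4 : D * (h * (E * h ^ (2 * s)) + h ^ (2 * s + 1)) = D * (E + 1) * h ^ (2 * s + 1) := by
      ring
    rw [h4]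
    gcongr
    linarith
  · have h3 : h ^ (2 * s) ≤ h ^ (s + 1) := pow_le_pow_of_le_one hh0.le hh1 (by omega)
    calc D * (E * h ^ (2 * s) + h ^ (s + 1)) ≤ D * (E * h ^ (s + 1) + h ^ (s + 1)) := by gcongr
      _ = D * (E + 1) * h ^ (s + 1) := by ring
      _ ≤ _ := by
        gcongr
        linarith

section Existence

variable {V : Type*} [NormedAddCommGroup V] [NormedSpace ℝ V]

/-- The coefficients `∑ i, b i P_j (c i) v i` computed from stage values `v`. -/
noncomputable def stageCoeff (c b : Fin k → ℝ) (v : Fin k → V) (j : ℕ) : V :=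
  ∑ i, (b i * (legendre j).eval (c i)) • v i

theorem norm_stepPoly_sub_le {κ : ℝ}
    (hκ : ∀ τ ∈ Icc (0 : ℝ) 1, ∑ j ∈ Finset.range s, ∑ i,
      |(legendre j).eval τ * (b i * (legendre j).eval (c i))| ≤ κ)
    {h : ℝ} (hh : 0 ≤ h) (v₀ : V) {v : Fin k → V} {B : ℝ} (hB : 0 ≤ B) (hv : ∀ i, ‖v i‖ ≤ B)
    {τ : ℝ} (hτ : τ ∈ Icc (0 : ℝ) 1) :
    ‖stepPoly s h v₀ (stageCoeff c b v) τ - v₀‖ ≤ h * (κ * B) := by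
  have hκ0 : 0 ≤ κ := le_trans (Finset.sum_nonneg fun _ _ => Finset.sum_nonneg fun _ _ =>
    abs_nonneg _) (hκ 0 (by simp))
  have := norm_image_sub_le_of_norm_deriv_le_segment' (C := h * (κ * B))
    (fun x _ => (hasDerivAt_stepPoly s h v₀ (stageCoeff c b v) x).hasDerivWithinAt
      (s := Icc (0 : ℝ) 1)) (fun x hx => by
        rw [norm_smul, Real.norm_of_nonneg hh]
        exact mul_le_mul_of_nonneg_left
          (norm_projection_le (hκ x (Ico_subset_Icc_self hx)) hB hv) hh) τ hτ
  rw [stepPoly_zero] at this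
  refine this.trans (mul_le_of_le_one_right (by positivity) ?_)
  linarith [hτ.2]

theorem stepPoly_stageCoeff_sub (s : ℕ) (c b : Fin k → ℝ) (h : ℝ) (v₀ : V) (v w : Fin k → V)
    (τ : ℝ) :
    stepPoly s h v₀ (stageCoeff c b v) τ - stepPoly s h v₀ (stageCoeff c b w) τ
      = stepPoly s h 0 (stageCoeff c b (v - w)) τ - 0 := by
  simp only [stepPoly, stageCoeff, Pi.sub_apply, smul_sub, Finset.sum_sub_distrib]
  abel

/-- The map whose fixed points are the stage values of a step is `1 / 2`-Lipschitz on the ball of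
radius `R`. -/
theorem norm_stepPoly_sub_stepPoly_le {κ : ℝ} (hc : ∀ i, c i ∈ Icc (0 : ℝ) 1)
    (hκ : ∀ τ ∈ Icc (0 : ℝ) 1, ∑ j ∈ Finset.range s, ∑ i,
      |(legendre j).eval τ * (b i * (legendre j).eval (c i))| ≤ κ)
    {h : ℝ} (hh : 0 ≤ h) {B R : ℝ} (hB : 0 ≤ B) (hκB : h * (κ * B) ≤ 1 / 2) {F : V → V}
    (hF : ∀ w z, ‖w‖ ≤ R → ‖z‖ ≤ R → ‖F w - F z‖ ≤ B * ‖w - z‖) (v₀ : V) {Y Z : Fin k → V}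
    (hY : ∀ i, ‖Y i‖ ≤ R) (hZ : ∀ i, ‖Z i‖ ≤ R) :
    ‖(fun i => stepPoly s h v₀ (stageCoeff c b fun l => F (Y l)) (c i))
      - (fun i => stepPoly s h v₀ (stageCoeff c b fun l => F (Z l)) (c i))‖
      ≤ 1 / 2 * ‖Y - Z‖ := by
  refine (pi_norm_le_iff_of_nonneg (by positivity)).2 fun i => ?_
  rw [Pi.sub_apply, stepPoly_stageCoeff_sub]
  refine (norm_stepPoly_sub_le hκ hh 0 (B := B * ‖Y - Z‖) (by positivity) (fun l => ?_)
    (hc i)).trans ?_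
  · refine (hF _ _ (hY l) (hZ l)).trans ?_
    gcongr
    exact norm_le_pi_norm (Y - Z) l
  · rw [← mul_assoc κ, ← mul_assoc h]
    gcongr

/-- Solvability of the stage equations of a step that starts inside the ball of radius `R`; the
polynomial of the step stays in that ball. -/
theorem exists_stage_fixedPoint [CompleteSpace V] {κ : ℝ} (hc : ∀ i, c i ∈ Icc (0 : ℝ) 1)
    (hκ : ∀ τ ∈ Icc (0 : ℝ) 1, ∑ j ∈ Finset.range s, ∑ i,
      |(legendre j).eval τ * (b i * (legendre j).eval (c i))| ≤ κ)
    {h : ℝ} (hh : 0 ≤ h) {B R : ℝ} (hB : 0 ≤ B) (hκB : h * (κ * B) ≤ 1 / 2) {F : V → V}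
    (hFB : ∀ w, ‖w‖ ≤ R → ‖F w‖ ≤ B)
    (hF : ∀ w z, ‖w‖ ≤ R → ‖z‖ ≤ R → ‖F w - F z‖ ≤ B * ‖w - z‖) {v₀ : V}
    (hv₀ : ‖v₀‖ + h * (κ * B) ≤ R) :
    ∃ Y : Fin k → V, (∀ i, stepPoly s h v₀ (stageCoeff c b fun l => F (Y l)) (c i) = Y i) ∧
      ∀ τ ∈ Icc (0 : ℝ) 1, ‖stepPoly s h v₀ (stageCoeff c b fun l => F (Y l)) τ‖ ≤ R := by
  have hκ0 : 0 ≤ κ := le_trans (Finset.sum_nonneg fun _ _ => Finset.sum_nonneg fun _ _ =>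
    abs_nonneg _) (hκ 0 (by simp))
  have hR : 0 ≤ R := le_trans (by positivity) hv₀
  set S : Set (Fin k → V) := Metric.closedBall 0 R with hS
  have hmem : ∀ Y, Y ∈ S ↔ ∀ i, ‖Y i‖ ≤ R := fun Y => by
    rw [hS, mem_closedBall_zero_iff, pi_norm_le_iff_of_nonneg hR]
  set Φ : (Fin k → V) → (Fin k → V) :=
    fun Y i => stepPoly s h v₀ (stageCoeff c b fun l => F (Y l)) (c i) with hΦ
  have hle : ∀ Y ∈ S, ∀ τ ∈ Icc (0 : ℝ) 1,
      ‖stepPoly s h v₀ (stageCoeff c b fun l => F (Y l)) τ‖ ≤ R := by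
    intro Y hY τ hτ
    have h1 := norm_stepPoly_sub_le hκ hh v₀ hB (v := fun l => F (Y l))
      (fun l => hFB _ ((hmem Y).1 hY l)) hτ
    have h2 := norm_le_norm_add_norm_sub' (stepPoly s h v₀ (stageCoeff c b fun l => F (Y l)) τ) v₀
    linarith
  have hmaps : MapsTo Φ S S := fun Y hY => (hmem _).2 fun i => hle Y hY _ (hc i)
  have hcontr : ContractingWith (1 / 2) (hmaps.restrict Φ S S) := by
    refine ⟨by norm_num, LipschitzWith.of_dist_le_mul fun Y Z => ?_⟩
    have := norm_stepPoly_sub_stepPoly_le hc hκ hh hB hκB hF v₀ ((hmem _).1 Y.2) ((hmem _).1 Z.2)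
    rw [Subtype.dist_eq, Subtype.dist_eq, dist_eq_norm, dist_eq_norm]
    simpa using this
  obtain ⟨Y, hY, hfix, -⟩ := hcontr.exists_fixedPoint' (Metric.isClosed_closedBall.isComplete) hmaps
    (x := 0) ((hmem _).2 fun i => by simpa using hR) (edist_ne_top _ _)
  exact ⟨Y, fun i => congrFun hfix i, hle Y hY⟩

end Existence

theorem fourierCoeff_congr {ν n : ℕ} (hν : 1 ≤ ν) (hc : ∀ i, c i ∈ Icc (0 : ℝ) 1)
    {u v : ℝ → EuclideanSpace ℝ (Fin m)}
    (huv : ∀ t ∈ Icc (0 : ℝ) (((n : ℝ) + 1) / ν), u t = v t) (j : ℕ) :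
    fourierCoeff f c b ν u n j = fourierCoeff f c b ν v n j := by
  refine Finset.sum_congr rfl fun i _ => ?_
  have h1 := mem_Icc_step (n := n) hν (hc i)
  have h0 : (0 : ℝ) ≤ (n : ℝ) / ν := by positivity
  rw [huv _ ⟨h0.trans h1.1, h1.2⟩, huv ((n / ν : ℕ) : ℝ) ⟨Nat.cast_nonneg _,
    (natCast_div_le_and_le hν).1.trans (by gcongr; linarith)⟩]

/-- The derivative of a step polynomial in the unscaled time. -/
theorem hasDerivAt_stepPoly_scaled {ν : ℕ} (hν : 1 ≤ ν) (n : ℕ) (v : EuclideanSpace ℝ (Fin m))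
    (g : ℕ → EuclideanSpace ℝ (Fin m)) (τ : ℝ) :
    HasDerivAt (fun t : ℝ => stepPoly s (1 / (ν : ℝ)) v g (t * ν - n))
      (∑ j ∈ Finset.range s, (legendre j).eval τ • g j) (((n : ℝ) + τ) / ν) := by
  have hν' : (ν : ℝ) ≠ 0 := by exact_mod_cast (by omega : ν ≠ 0)
  have h1 : HasDerivAt (fun t : ℝ => t * ν - n) (ν : ℝ) (((n : ℝ) + τ) / ν) := by
    simpa using ((hasDerivAt_id (((n : ℝ) + τ) / ν)).mul_const (ν : ℝ)).sub_const (n : ℝ)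
  have hτ : ((n : ℝ) + τ) / ν * ν - n = τ := by field_simp; ring
  have h2 := hasDerivAt_stepPoly s (1 / (ν : ℝ)) v g τ
  rw [← hτ] at h2
  have h3 := HasDerivAt.scomp (h := fun t : ℝ => t * ν - n) (((n : ℝ) + τ) / ν) h2 h1
  rw [smul_smul, mul_one_div_cancel hν', one_smul, hτ] at h3
  exact h3

/-- An approximation on the first `N` steps extends to one more step when the stage equations of
that step are solvable. -/
theorem IsHBVMSteps.extend {ν N : ℕ} (hν : 1 ≤ ν) (hc : ∀ i, c i ∈ Icc (0 : ℝ) 1)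
    {u : ℝ → EuclideanSpace ℝ (Fin m)} (hu : IsHBVMSteps f y₀ N ν s c b u)
    {Y : Fin k → EuclideanSpace ℝ (Fin m)}
    (hY : ∀ i, stepPoly s (1 / (ν : ℝ)) (u ((N : ℝ) / ν))
      (stageCoeff c b fun l => f (Y l, u ((N / ν : ℕ) : ℝ))) (c i) = Y i) :
    ∃ u', IsHBVMSteps f y₀ (N + 1) ν s c b u' ∧ (∀ t ≤ (N : ℝ) / ν, u' t = u t) ∧
      ∀ t, (N : ℝ) / ν ≤ t → u' t = stepPoly s (1 / (ν : ℝ)) (u ((N : ℝ) / ν))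
        (stageCoeff c b fun l => f (Y l, u ((N / ν : ℕ) : ℝ))) (t * ν - N) := by
  have hν' : (0 : ℝ) < ν := by exact_mod_cast hν
  set p := stepPoly s (1 / (ν : ℝ)) (u ((N : ℝ) / ν))
        (stageCoeff c b fun l => f (Y l, u ((N / ν : ℕ) : ℝ))) with hp
  set u' : ℝ → EuclideanSpace ℝ (Fin m) :=
    fun t => if t ≤ (N : ℝ) / ν then u t else p (t * ν - N) with hu'
  have hl : ∀ t ≤ (N : ℝ) / ν, u' t = u t := fun t ht => if_pos ht
  have hr : ∀ t, (N : ℝ) / ν ≤ t → u' t = p (t * ν - N) := by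
    intro t ht
    rcases ht.eq_or_lt with rfl | ht
    · rw [hl _ le_rfl, div_mul_cancel₀ _ hν'.ne', sub_self, hp, stepPoly_zero]
    · exact if_neg (not_le.2 ht)
  refine ⟨u', ⟨?_, fun n hn τ hτ => ?_⟩, hl, hr⟩
  · rw [hl 0 (by positivity), hu.initial]
  have hmem := mem_Icc_step (n := n) hν hτ
  rcases Nat.lt_or_ge n N with hlt | hge
  · have hle : ((n : ℝ) + 1) / ν ≤ (N : ℝ) / ν := by
      gcongr
      exact_mod_cast hlt
    simp_rw [fourierCoeff_congr (f := f) (b := b) hν hc fun t ht => hl t (ht.2.trans hle)]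
    exact (hu.hasDeriv n hlt τ hτ).congr (fun t ht => hl t (ht.2.trans hle))
      (hl _ (hmem.2.trans hle))
  · obtain rfl : n = N := by omega
    have hcoef : ∀ j, fourierCoeff f c b ν u' n j
        = stageCoeff c b (fun l => f (Y l, u ((n / ν : ℕ) : ℝ))) j := by
      intro j
      refine Finset.sum_congr rfl fun i _ => ?_
      rw [hr _ (mem_Icc_step hν (hc i)).1, hl _ (natCast_div_le_and_le hν).1]
      have hτ : ((n : ℝ) + c i) / ν * ν - n = c i := by field_simp; ring
      rw [hτ, hY i]
    simp_rw [hcoef]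
    exact (hasDerivAt_stepPoly_scaled hν n _ _ τ).hasDerivWithinAt.congr
      (fun t ht => hr t ht.1) (hr _ hmem.1)

/-- The error estimate keeps the approximation away from the boundary of the ball of radius `R`, so
that the contraction argument applies at every step. -/
theorem exists_bounded_approx (hs : 1 ≤ s)
    (hf : ContDiff ℝ ((2 * s : ℕ) : WithTop ℕ∞) f) (hy : IsFDEPCASolution f y₀ K y)
    (hc : ∀ i, c i ∈ Icc (0 : ℝ) 1) (hq : HasQuadratureOrder c b q) (hqs : 2 * s ≤ q)
    {R : ℝ} (hR : ∀ t ∈ Icc (0 : ℝ) K, ‖y t‖ < R) :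
    ∃ ν₀ : ℕ, ∀ ν : ℕ, ν₀ ≤ ν → 1 ≤ ν → ∀ N ≤ K * ν, ∃ u,
      IsHBVMSteps f y₀ N ν s c b u ∧ ∀ t ∈ Icc (0 : ℝ) ((N : ℝ) / ν), ‖u t‖ ≤ R := by
  obtain ⟨t₀, ht₀, hmax⟩ := (isCompact_Icc (a := (0 : ℝ)) (b := K)).exists_isMaxOn
    ⟨0, le_rfl, Nat.cast_nonneg K⟩ hy.continuousOn.norm
  set ρ : ℝ := R - ‖y t₀‖ with hρ
  have hρ0 : 0 < ρ := sub_pos.2 (hR t₀ ht₀)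
  have hyρ : ∀ t ∈ Icc (0 : ℝ) K, ‖y t‖ ≤ R - ρ := fun t ht => by
    rw [hρ, sub_sub_cancel]
    exact hmax ht
  obtain ⟨D, ν₁, hD, herr⟩ := exists_error_bound hs hf hy hc hq hqs (fun t ht => (hR t ht).le)
  obtain ⟨B, hB0, hB, hBf⟩ := exists_bounds_on_closedBall (hf.of_le (m := 2)
    (by exact_mod_cast (by omega))) R
  obtain ⟨κ, hκ0, hκ⟩ := exists_kernel_bound s c b
  have hκB0 : 0 ≤ κ * B := by positivity
  refine ⟨max ν₁ ⌈max (2 * (κ * B)) (2 * (κ * B + D) / ρ)⌉₊, fun ν hν₀ hν N => ?_⟩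
  have hν' : (0 : ℝ) < ν := by exact_mod_cast hν
  have hν2 := Nat.ceil_le.1 ((le_max_right _ _).trans hν₀)
  have hν3 : 2 * (κ * B) ≤ ν := (le_max_left _ _).trans hν2
  have hν4 : 2 * (κ * B + D) ≤ ν * ρ :=
    (div_le_iff₀ hρ0).1 ((le_max_right _ _).trans hν2)
  set h : ℝ := 1 / (ν : ℝ) with hh
  have hh0 : 0 < h := by positivity
  have hh1 : h ≤ 1 := by
    rw [hh, div_le_one hν']
    exact_mod_cast hν
  have hhν : h * ν = 1 := by rw [hh]; field_simp
  have hκB : h * (κ * B) ≤ 1 / 2 := by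
    have := mul_le_mul_of_nonneg_left hν3 hh0.le
    linarith
  have hκD : h * (κ * B) + h * D ≤ ρ / 2 := by
    have := mul_le_mul_of_nonneg_left hν4 hh0.le
    rw [← mul_assoc h ν ρ, hhν] at this
    linarith
  induction N with
  | zero =>
    refine fun _ => ⟨fun _ => y₀, ⟨rfl, fun n hn => absurd hn (by omega)⟩, fun t _ => ?_⟩
    rw [← hy.initial]
    exact (hR 0 ⟨le_rfl, Nat.cast_nonneg K⟩).le
  | succ N ih =>
    intro hN
    obtain ⟨u, hu, huR⟩ := ih (by omega)
    have hNK : (N : ℝ) / ν ≤ K := by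
      rw [div_le_iff₀ hν']
      exact_mod_cast (by omega : N ≤ K * ν)
    have hN0 : (0 : ℝ) ≤ (N : ℝ) / ν := by positivity
    have he := (herr ν N ((le_max_left _ _).trans hν₀) hν (by omega) u hu huR).1 N le_rfl
    have hp : h ^ (2 * s) ≤ h := pow_le_of_le_one hh0.le hh1 (by omega)
    have hv₀ : ‖u ((N : ℝ) / ν)‖ + h * (κ * B) ≤ R := by
      have h1 := norm_le_norm_add_norm_sub' (u ((N : ℝ) / ν)) (y ((N : ℝ) / ν))
      rw [norm_sub_rev] at h1
      have h2 := hyρ _ ⟨hN0, hNK⟩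
      have h3 : D * h ^ (2 * s) ≤ D * h := by gcongr
      linarith
    have hκR : ‖u ((N / ν : ℕ) : ℝ)‖ ≤ R :=
      huR _ ⟨Nat.cast_nonneg _, (natCast_div_le_and_le hν).1⟩
    obtain ⟨Y, hY, hYR⟩ := exists_stage_fixedPoint hc hκ hh0.le hB0 hκB
      (F := fun v => f (v, u ((N / ν : ℕ) : ℝ)))
      (fun w hw => (hB (w, u ((N / ν : ℕ) : ℝ)) (max_le hw hκR)).1)
      (fun w z hw hz => by
        have := (hBf (w, u ((N / ν : ℕ) : ℝ)) (z, u ((N / ν : ℕ) : ℝ))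
          (max_le hw hκR) (max_le hz hκR)).1
        simpa [Prod.norm_def] using this) hv₀
    obtain ⟨u', hu', hl, hr⟩ := hu.extend hν hc hY
    refine ⟨u', hu', fun t ht => ?_⟩
    rcases le_total t ((N : ℝ) / ν) with h1 | h1
    · rw [hl t h1]
      exact huR t ⟨ht.1, h1⟩
    · rw [hr t h1]
      refine hYR _ ⟨?_, ?_⟩
      · rw [sub_nonneg]
        exact (div_le_iff₀ hν').1 h1
      · have := (le_div_iff₀ hν').1 ht.2
        push_cast at this
        linarith

/-- For small stepsizes there is at most one approximation in the ball of radius `R`. -/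
theorem exists_eqOn_of_bounded (hs : 1 ≤ s) (hf : ContDiff ℝ ((2 * s : ℕ) : WithTop ℕ∞) f)
    (y₀ : EuclideanSpace ℝ (Fin m)) (hc : ∀ i, c i ∈ Icc (0 : ℝ) 1) (R : ℝ) :
    ∃ ν₀ : ℕ, ∀ ν : ℕ, ν₀ ≤ ν → 1 ≤ ν → ∀ (N : ℕ) (u v : ℝ → EuclideanSpace ℝ (Fin m)),
      IsHBVMSteps f y₀ N ν s c b u → IsHBVMSteps f y₀ N ν s c b v →
      (∀ t ∈ Icc (0 : ℝ) ((N : ℝ) / ν), ‖u t‖ ≤ R) →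
      (∀ t ∈ Icc (0 : ℝ) ((N : ℝ) / ν), ‖v t‖ ≤ R) →
      ∀ n ≤ N, EqOn u v (Icc 0 ((n : ℝ) / ν)) := by
  obtain ⟨B, hB0, -, hBf⟩ := exists_bounds_on_closedBall (hf.of_le (m := 2)
    (by exact_mod_cast (by omega))) R
  obtain ⟨κ, hκ0, hκ⟩ := exists_kernel_bound s c b
  refine ⟨⌈2 * (κ * B)⌉₊, fun ν hν₀ hν N u v hu hv huR hvR n => ?_⟩
  have hν' : (0 : ℝ) < ν := by exact_mod_cast hν
  have hh0 : (0 : ℝ) ≤ 1 / ν := by positivity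
  have hκB : 1 / (ν : ℝ) * (κ * B) ≤ 1 / 2 := by
    have := Nat.ceil_le.1 hν₀
    rw [one_div_mul_eq_div, div_le_iff₀ hν']
    linarith
  induction n with
  | zero =>
    intro _ t ht
    obtain rfl : t = 0 := le_antisymm (by simpa using ht.2) ht.1
    rw [hu.initial, hv.initial]
  | succ n ih =>
    intro hn t ht
    have ih' := ih (by omega)
    have hn0 : (0 : ℝ) ≤ (n : ℝ) / ν := by positivity
    rcases le_total t ((n : ℝ) / ν) with h1 | h1
    · exact ih' ⟨ht.1, h1⟩
    have hnN : ((n : ℝ) + 1) / ν ≤ (N : ℝ) / ν := by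
      gcongr
      exact_mod_cast hn
    have hlt : n < N := by omega
    have hmem : ∀ i, ((n : ℝ) + c i) / ν ∈ Icc (0 : ℝ) ((N : ℝ) / ν) := fun i =>
      ⟨hn0.trans (mem_Icc_step hν (hc i)).1, (mem_Icc_step hν (hc i)).2.trans hnN⟩
    have hnn : (n : ℝ) / ν ≤ ((n : ℝ) + 1) / ν := by gcongr; linarith
    have hκmem : ((n / ν : ℕ) : ℝ) ∈ Icc (0 : ℝ) ((n : ℝ) / ν) :=
      ⟨Nat.cast_nonneg _, (natCast_div_le_and_le hν).1⟩
    have hv₀ : u ((n : ℝ) / ν) = v ((n : ℝ) / ν) := ih' ⟨hn0, le_rfl⟩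
    have hκeq : u ((n / ν : ℕ) : ℝ) = v ((n / ν : ℕ) : ℝ) := ih' hκmem
    have hκR : ‖u ((n / ν : ℕ) : ℝ)‖ ≤ R := huR _ ⟨hκmem.1, hκmem.2.trans (hnn.trans hnN)⟩
    set F : EuclideanSpace ℝ (Fin m) → EuclideanSpace ℝ (Fin m) :=
      fun w => f (w, u ((n / ν : ℕ) : ℝ)) with hF
    have hFL : ∀ w z, ‖w‖ ≤ R → ‖z‖ ≤ R → ‖F w - F z‖ ≤ B * ‖w - z‖ := fun w z hw hz => by
      have := (hBf (w, u ((n / ν : ℕ) : ℝ)) (z, u ((n / ν : ℕ) : ℝ))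
        (max_le hw hκR) (max_le hz hκR)).1
      simpa [Prod.norm_def] using this
    set Y : Fin k → EuclideanSpace ℝ (Fin m) := fun i => u (((n : ℝ) + c i) / ν) with hY
    set Z : Fin k → EuclideanSpace ℝ (Fin m) := fun i => v (((n : ℝ) + c i) / ν) with hZ
    have hcu : fourierCoeff f c b ν u n = stageCoeff c b fun l => F (Y l) := rfl
    have hcv : fourierCoeff f c b ν v n = stageCoeff c b fun l => F (Z l) := by
      funext j
      simp only [fourierCoeff, stageCoeff, hF, hZ, hκeq]
    have hYf : (fun i => stepPoly s (1 / (ν : ℝ)) (u ((n : ℝ) / ν))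
        (stageCoeff c b fun l => F (Y l)) (c i)) = Y := by
      funext i
      rw [← hcu, ← hu.eq_stepPoly hν hlt (hc i)]
    have hZf : (fun i => stepPoly s (1 / (ν : ℝ)) (u ((n : ℝ) / ν))
        (stageCoeff c b fun l => F (Z l)) (c i)) = Z := by
      funext i
      rw [← hcv, hv₀, ← hv.eq_stepPoly hν hlt (hc i)]
    have hcon := norm_stepPoly_sub_stepPoly_le hc hκ hh0 hB0 hκB hFL (u ((n : ℝ) / ν))
      (Y := Y) (Z := Z) (fun i => huR _ (hmem i)) (fun i => hvR _ (hmem i))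
    rw [hYf, hZf] at hcon
    have hYZ : Y = Z := by
      rw [← sub_eq_zero, ← norm_le_zero_iff]
      linarith
    have hτ : t * ν - n ∈ Icc (0 : ℝ) 1 := by
      constructor
      · rw [sub_nonneg]
        exact (div_le_iff₀ hν').1 h1
      · have := (le_div_iff₀ hν').1 ht.2
        push_cast at this
        linarith
    have ht' : t = ((n : ℝ) + (t * ν - n)) / ν := by field_simp; ring
    rw [ht', hu.eq_stepPoly hν hlt hτ, hv.eq_stepPoly hν hlt hτ, hcu, hcv, hYZ, hv₀]

end HBVM

/-! ### The convergence theorem -/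

theorem mainTheorem1 {m k : ℕ} (s q K : ℕ) (hs : 1 ≤ s)
    (f : EuclideanSpace ℝ (Fin m) × EuclideanSpace ℝ (Fin m) → EuclideanSpace ℝ (Fin m))
    (hf : ContDiff ℝ ((2 * s : ℕ) : WithTop ℕ∞) f)
    (y₀ : EuclideanSpace ℝ (Fin m)) (y : ℝ → EuclideanSpace ℝ (Fin m))
    (hy : HBVM.IsFDEPCASolution f y₀ K y)
    (c b : Fin k → ℝ) (hc : ∀ i, c i ∈ Set.Icc (0 : ℝ) 1)
    (hq : HBVM.HasQuadratureOrder c b q) (hqs : 2 * s ≤ q)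
    (R : ℝ) (hR : ∀ t ∈ Set.Icc (0 : ℝ) K, ‖y t‖ < R) :
    (∃ ν₀ : ℕ, ∀ ν : ℕ, ν₀ ≤ ν → 1 ≤ ν →
      ∃ u : ℝ → EuclideanSpace ℝ (Fin m),
        HBVM.IsHBVMApprox f y₀ K ν s c b u ∧
        (∀ t ∈ Set.Icc (0 : ℝ) K, ‖u t‖ ≤ R) ∧
        ∀ v : ℝ → EuclideanSpace ℝ (Fin m),
          HBVM.IsHBVMApprox f y₀ K ν s c b v → (∀ t ∈ Set.Icc (0 : ℝ) K, ‖v t‖ ≤ R) →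
          Set.EqOn v u (Set.Icc (0 : ℝ) K)) ∧
    (∃ C : ℝ, ∀ ν : ℕ, 1 ≤ ν → ∀ u : ℝ → EuclideanSpace ℝ (Fin m),
      HBVM.IsHBVMApprox f y₀ K ν s c b u → (∀ t ∈ Set.Icc (0 : ℝ) K, ‖u t‖ ≤ R) →
      (∀ n : ℕ, 1 ≤ n → n ≤ K * ν →
        ‖(y ((n : ℝ) / ν) - u ((n : ℝ) / ν))
            - (y (((n : ℝ) - 1) / ν) - u (((n : ℝ) - 1) / ν))‖
          ≤ C * (1 / (ν : ℝ)) ^ (2 * s + 1)) ∧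
      (∀ n : ℕ, 1 ≤ n → n ≤ K * ν → ∀ τ ∈ Set.Ioo (0 : ℝ) 1,
        ‖y (((n : ℝ) - 1 + τ) / ν) - u (((n : ℝ) - 1 + τ) / ν)‖
          ≤ C * (1 / (ν : ℝ)) ^ (s + 1)) ∧
      (∀ n : ℕ, n ≤ K * ν →
        ‖y ((n : ℝ) / ν) - u ((n : ℝ) / ν)‖ ≤ C * (1 / (ν : ℝ)) ^ (2 * s))) := by
  have hend : ∀ ν : ℕ, 1 ≤ ν → ((K * ν : ℕ) : ℝ) / ν = K := fun ν hν => by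
    have : (ν : ℝ) ≠ 0 := by exact_mod_cast (by omega : ν ≠ 0)
    push_cast
    field_simp
  constructor
  · obtain ⟨ν₁, h₁⟩ := HBVM.exists_bounded_approx hs hf hy hc hq hqs hR
    obtain ⟨ν₂, h₂⟩ := HBVM.exists_eqOn_of_bounded (b := b) hs hf y₀ hc R
    refine ⟨max ν₁ ν₂, fun ν hν₀ hν => ?_⟩
    obtain ⟨u, hu, huR⟩ := h₁ ν ((le_max_left _ _).trans hν₀) hν (K * ν) le_rfl
    have h₃ := h₂ ν ((le_max_right _ _).trans hν₀) hν (K * ν)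
    rw [hend ν hν] at huR h₃
    refine ⟨u, HBVM.isHBVMApprox_iff.2 hu, huR, fun v hv hvR => ?_⟩
    have := h₃ v u (HBVM.isHBVMApprox_iff.1 hv) hu hvR huR (K * ν) le_rfl
    rwa [hend ν hν] at this
  · obtain ⟨D, ν₀, hD, herr⟩ :=
      HBVM.exists_error_bound hs hf hy hc hq hqs (fun t ht => (hR t ht).le)
    have hR0 : 0 ≤ R := (norm_nonneg _).trans (hR 0 ⟨le_rfl, Nat.cast_nonneg K⟩).le
    refine ⟨D + 4 * R * (ν₀ : ℝ) ^ (2 * s + 1), fun ν hν u hu huR => ?_⟩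
    have hν' : (0 : ℝ) < ν := by exact_mod_cast hν
    have hh0 : (0 : ℝ) ≤ 1 / ν := by positivity
    rcases Nat.lt_or_ge ν ν₀ with hlt | hge
    · -- for the finitely many large stepsizes the boundedness of `y` and `u` suffices
      have hone : (1 : ℝ) ≤ ν₀ := by exact_mod_cast hν.trans hlt.le
      have hsmall : ∀ p ≤ 2 * s + 1,
          4 * R ≤ (D + 4 * R * (ν₀ : ℝ) ^ (2 * s + 1)) * (1 / (ν : ℝ)) ^ p := by
        intro p hp
        have h1 : (1 : ℝ) ≤ (ν₀ : ℝ) ^ p * (1 / (ν : ℝ)) ^ p := by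
          rw [← mul_pow]
          refine one_le_pow₀ ?_
          rw [mul_one_div, le_div_iff₀ hν', one_mul]
          exact_mod_cast hlt.le
        have h2 : (ν₀ : ℝ) ^ p ≤ (ν₀ : ℝ) ^ (2 * s + 1) := pow_le_pow_right₀ hone hp
        calc 4 * R ≤ 4 * R * ((ν₀ : ℝ) ^ p * (1 / (ν : ℝ)) ^ p) :=
              le_mul_of_one_le_right (by positivity) h1
          _ ≤ 4 * R * ((ν₀ : ℝ) ^ (2 * s + 1) * (1 / (ν : ℝ)) ^ p) := by gcongr
          _ = 4 * R * (ν₀ : ℝ) ^ (2 * s + 1) * (1 / (ν : ℝ)) ^ p := by ring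
          _ ≤ _ := by
            gcongr
            linarith
      have hbd : ∀ x : ℝ, 0 ≤ x → x ≤ (K * ν : ℕ) → ‖y (x / ν) - u (x / ν)‖ ≤ 2 * R := by
        intro x hx0 hx
        have hmem : x / ν ∈ Set.Icc (0 : ℝ) K := by
          refine ⟨by positivity, ?_⟩
          rw [← hend ν hν]
          gcongr
        refine (norm_sub_le _ _).trans ?_
        linarith [hR _ hmem, huR _ hmem]
      refine ⟨fun n hn1 hn => ?_, fun n hn1 hn τ hτ => ?_, fun n hn => ?_⟩
      · have h1 : (1 : ℝ) ≤ n := by exact_mod_cast hn1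
        have h2 : (n : ℝ) ≤ (K * ν : ℕ) := by exact_mod_cast hn
        refine (norm_sub_le _ _).trans (le_trans ?_ (hsmall (2 * s + 1) le_rfl))
        linarith [hbd n (by linarith) h2, hbd (n - 1) (by linarith) (by linarith)]
      · have h1 : (1 : ℝ) ≤ n := by exact_mod_cast hn1
        have h2 : (n : ℝ) ≤ (K * ν : ℕ) := by exact_mod_cast hn
        refine le_trans ?_ (hsmall (s + 1) (by omega))
        linarith [hbd (n - 1 + τ) (by linarith [hτ.1]) (by linarith [hτ.2])]
      · have h2 : (n : ℝ) ≤ (K * ν : ℕ) := by exact_mod_cast hn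
        refine le_trans ?_ (hsmall (2 * s) (by omega))
        linarith [hbd n (Nat.cast_nonneg n) h2]
    · obtain ⟨h1, h2⟩ := herr ν (K * ν) hge hν le_rfl u (HBVM.isHBVMApprox_iff.1 hu)
        (by rwa [hend ν hν])
      have hC : ∀ p : ℕ, D * (1 / (ν : ℝ)) ^ p
          ≤ (D + 4 * R * (ν₀ : ℝ) ^ (2 * s + 1)) * (1 / (ν : ℝ)) ^ p := fun p => by
        have : 0 ≤ 4 * R * (ν₀ : ℝ) ^ (2 * s + 1) := by positivity
        gcongr
        linarith
      refine ⟨fun n hn1 hn => ?_, fun n hn1 hn τ hτ => ?_, fun n hn => (h1 n hn).trans (hC _)⟩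
      · obtain ⟨n, rfl⟩ := Nat.exists_eq_add_of_le' hn1
        have := (h2 n (by omega)).1
        push_cast
        rw [add_sub_cancel_right]
        exact this.trans (hC _)
      · obtain ⟨n, rfl⟩ := Nat.exists_eq_add_of_le' hn1
        have := (h2 n (by omega)).2 τ (Set.Ioo_subset_Icc_self hτ)
        push_cast
        rw [add_sub_cancel_right]
        exact this.trans (hC _)
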